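/- Let $E$ be an elliptic curve over an algebraically closed field $k$ of characteristic $0$. Let $\alpha_1,\alpha_2,\beta_1,\beta_2,\gamma_1,\gamma_2$ be points of $E$ such that, for the group law of $E$: 1. the sets $\{\alpha_1,\alpha_2\}$, $\{\beta_1,\beta_2\}$, $\{\gamma_1,\gamma_2\}$ are pairwise disjoint; 2. $\beta_1\neq\beta_2$; 3. $\alpha_1+\alpha_2-\gamma_1-\beta_1\neq 0$ and $\alpha_1+\alpha_2-\gamma_1-\beta_2\neq 0$; 4. the points $\alpha_1+\alpha_2$, $\beta_1+\beta_2$, $\gamma_1+\gamma_2$ are mutually different. Write $(g)$ for the divisor of a non-zero rational function $g$ on $E$; the degree of $g$ is the number of its zeros counted with multiplicities. Then there is a rational function $g$ on $E$ with $g(\beta_1)=g(\beta_2)=1$ such that at least one of the following holds: 1. $g$ has degree $3$ and $(g)=[\alpha_1]+[\alpha_2]+[\alpha']-[\gamma_1]-[\gamma_2]-[\gamma']$ for some points $\alpha',\gamma'\in E$; 2. $g$ has degree $2$ and $(g)=[\alpha_1]+[\alpha_2]-[\gamma_j]-[\gamma']$ for some $j\in\{1,2\}$ and some point $\gamma'\in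 E$; 3. $g$ has degree $2$ and $(g)=[\alpha_j]+[\alpha']-[\gamma_1]-[\gamma_2]$ for some $j\in\{1,2\}$ and some point $\alpha'\in E$. -/

import Mathlib

open scoped Polynomial Polynomial.Bivariate

namespace WeierstrassCurve.Affine

variable {k : Type*} [Field k] (W : WeierstrassCurve.Affine k)

/-- The coordinate function `x` in the function field of `W`. -/
noncomputable def xFun : W.FunctionField :=
  algebraMap W.CoordinateRing W.FunctionField (CoordinateRing.mk W (Polynomial.C Polynomial.X))

/-- The coordinate function `y` in the function field of `W`. -/
noncomputable def yFun : W.FunctionField :=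
  algebraMap W.CoordinateRing W.FunctionField (CoordinateRing.mk W Polynomial.X)

variable {W}

/-- The affine coordinates used near a point `P`: in the plane with homogeneous coordinates
`[X : Y : Z]`, `x = X / Z` and `y = Y / Z` for a point of the affine curve, and `X / Y = x / y`,
`Z / Y = 1 / y` for the point at infinity `[0 : 1 : 0]`. -/
noncomputable def chartFun : W.Point → W.FunctionField × W.FunctionField
  | .zero => (W.xFun / W.yFun, 1 / W.yFun)
  | .some _ _ _ => (W.xFun, W.yFun)

/-- The coordinates of the point `P` itself in the affine chart `chartFun P`. -/
def chartPt : W.Point → k × k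
  | .zero => (0, 0)
  | .some x y _ => (x, y)

/-- The rational function `f` is regular at `P` with value `c = f(P)`: it can be written as `F / G`
with polynomials `F`, `G` in the affine coordinates near `P` such that `G(P) ≠ 0` and
`F(P) / G(P) = c`. -/
def HasValue (P : W.Point) (f : W.FunctionField) (c : k) : Prop :=
  ∃ F G : k[X][Y],
    G.evalEval (chartPt P).1 (chartPt P).2 ≠ 0 ∧
    f * G.aevalAeval (chartFun P).1 (chartFun P).2 = F.aevalAeval (chartFun P).1 (chartFun P).2 ∧
    c = F.evalEval (chartPt P).1 (chartPt P).2 / G.evalEval (chartPt P).1 (chartPt P).2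

/-- `t` is a uniformizer at `P`: a nonzero generator of the maximal ideal (the functions vanishing
at `P`) of the local ring of `W` at `P` (the functions regular at `P`). -/
def IsUniformizer (P : W.Point) (t : W.FunctionField) : Prop :=
  t ≠ 0 ∧ HasValue P t 0 ∧
    ∀ f : W.FunctionField, HasValue P f 0 → ∃ (h : W.FunctionField) (c : k), HasValue P h c ∧ f = t * h

/-- The order of vanishing `ord_P(f)` of the nonzero rational function `f` is `n`:
`f = t ^ n * u` with a uniformizer `t` at `P` and a unit `u` of the local ring at `P`. -/
def HasOrder (P : W.Point) (f : W.FunctionField) (n : ℤ) : Prop :=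
  ∃ (t u : W.FunctionField) (c : k),
    IsUniformizer P t ∧ HasValue P u c ∧ c ≠ 0 ∧ f = t ^ n * u

/-- The divisor of the nonzero rational function `f` is `D = ∑ D(P) [P]`. -/
def HasDivisor (f : W.FunctionField) (D : W.Point →₀ ℤ) : Prop :=
  ∀ P : W.Point, HasOrder P f (D P)

/-- The degree of the nonzero rational function `f`, that is, the number of its zeros counted with
multiplicities, is `n`. -/
def HasDegree (f : W.FunctionField) (n : ℕ) : Prop :=
  ∃ D : W.Point →₀ ℤ, HasDivisor f D ∧ D.sum (fun _ m => m.toNat) = n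

/-- The divisor `[P]`. -/
noncomputable def pt (P : W.Point) : W.Point →₀ ℤ :=
  Finsupp.single P 1

end WeierstrassCurve.Affine

namespace WeierstrassCurve.Affine

section

variable {k : Type*} [Field k] {W : WeierstrassCurve.Affine k}

/-! ### The filtration of the coordinate ring by the pole order at infinity -/

/-! Let `u` have polar divisor [γ₁]+[γ₂] and `v` polar divisor [α₁]+[α₂]. The fibres of such a
function of degree two are the pairs of points with the same sum as its poles. Since β₁+β₂ differs
from both sums, each function separates β₁ from β₂, so an affine change of `v` makes u = v at both.
Now u - v has poles α₁, α₂, γ₁, γ₂, zeros β₁, β₂ and two further zeros; let p be one of these and c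
= u(p) = v(p). In g = (u - c)/(v - c) the zero p cancels, leaving zeros α₁, α₂, γ₁+γ₂-p and poles
γ₁, γ₂, α₁+α₂-p. Nothing else cancels because α₁+α₂ ≠ γ₁+γ₂, so g has degree 3 and the first
alternative always occurs. That g = 1 at β₁ and β₂ is clear where v ≠ c, and otherwise follows by
comparing orders of vanishing (`exists_ratio_of_isPencil`).

The function theory underneath is explicit. Chords, tangents and vertical lines supply the functions
of degree two (`exists_hasDivisor_pencilFun_sub`, `exists_isPencil`). The two further zeros come
from `exists_hasDivisor_of_orderGE`: division by a suitable product reduces to L([0]+[e]), which is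
spanned by 1 and `pencilFun e`. That space is found from the coordinate ring and pole orders at
infinity (`exists_eq_linear`, `exists_eq_pencilFun`), in place of Riemann–Roch. -/

lemma degree_norm_add_le (a b : W.CoordinateRing) :
    (Algebra.norm k[X] (a + b)).degree ≤
      max (Algebra.norm k[X] a).degree (Algebra.norm k[X] b).degree := by
  obtain ⟨p, q, rfl⟩ := CoordinateRing.exists_smul_basis_eq a
  obtain ⟨r, s, rfl⟩ := CoordinateRing.exists_smul_basis_eq b
  have key : p • (1 : W.CoordinateRing) + q • CoordinateRing.mk W Polynomial.X +
      (r • (1 : W.CoordinateRing) + s • CoordinateRing.mk W Polynomial.X) =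
      (p + r) • (1 : W.CoordinateRing) + (q + s) • CoordinateRing.mk W Polynomial.X := by
    rw [add_smul, add_smul]; abel
  -- The norm of p + qY has degree max(2 deg p, 2 deg q + 3), so the bound can be checked on p and q
  -- separately.
  rw [key, CoordinateRing.degree_norm_smul_basis, CoordinateRing.degree_norm_smul_basis,
    CoordinateRing.degree_norm_smul_basis]
  have h₁ := Polynomial.degree_add_le p r
  have h₂ := Polynomial.degree_add_le q s
  have mono2 : ∀ {a b : WithBot ℕ}, a ≤ b → 2 • a ≤ 2 • b := fun h ↦ by
    rw [two_nsmul, two_nsmul]; exact add_le_add h h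
  refine max_le ?_ ?_
  · rcases le_max_iff.1 h₁ with h | h
    · exact (mono2 h).trans ((le_max_left _ _).trans (le_max_left _ _))
    · exact (mono2 h).trans ((le_max_left _ _).trans (le_max_right _ _))
  · rcases le_max_iff.1 h₂ with h | h
    · exact (add_le_add_left (mono2 h) 3).trans ((le_max_right _ _).trans (le_max_left _ _))
    · exact (add_le_add_left (mono2 h) 3).trans ((le_max_right _ _).trans (le_max_right _ _))

lemma degree_norm_ne_bot {a : W.CoordinateRing} (ha : a ≠ 0) :
    (Algebra.norm k[X] a).degree ≠ ⊥ := by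
  rw [Ne, Polynomial.degree_eq_bot]
  have := Module.Finite.of_basis (CoordinateRing.basis W)
  exact Algebra.norm_ne_zero_iff.2 ha

lemma degree_norm_algebraMap_mul (c : k) (a : W.CoordinateRing) :
    (Algebra.norm k[X] (algebraMap k W.CoordinateRing c * a)).degree ≤
      (Algebra.norm k[X] a).degree := by
  rw [map_mul, Polynomial.degree_mul,
    IsScalarTower.algebraMap_apply k k[X] W.CoordinateRing, Algebra.norm_algebraMap]
  have h : (algebraMap k k[X] c ^ Module.finrank k[X] W.CoordinateRing).degree ≤ 0 := by
    refine Polynomial.natDegree_eq_zero_iff_degree_le_zero.1 ?_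
    rw [Polynomial.algebraMap_apply, Polynomial.natDegree_pow]
    simp
  simpa using add_le_add h le_rfl

/-- The functions on `W` whose pole order at infinity, computed through the norm, is at most `0`. -/
def boundedAtInfinity (W : WeierstrassCurve.Affine k) : Subalgebra k W.FunctionField where
  carrier := {f | ∃ a b : W.CoordinateRing, b ≠ 0 ∧ f * algebraMap _ _ b = algebraMap _ _ a ∧
    (Algebra.norm k[X] a).degree ≤ (Algebra.norm k[X] b).degree}
  mul_mem' := by
    rintro f g ⟨a, b, hb, hf, hab⟩ ⟨c, d, hd, hg, hcd⟩
    refine ⟨a * c, b * d, mul_ne_zero hb hd, ?_, ?_⟩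
    · rw [map_mul, map_mul, ← hf, ← hg]; ring
    · rw [map_mul, map_mul, Polynomial.degree_mul, Polynomial.degree_mul]
      exact add_le_add hab hcd
  add_mem' := by
    rintro f g ⟨a, b, hb, hf, hab⟩ ⟨c, d, hd, hg, hcd⟩
    refine ⟨a * d + c * b, b * d, mul_ne_zero hb hd, ?_, ?_⟩
    · rw [map_add, map_mul, map_mul, map_mul, ← hf, ← hg]; ring
    · refine (degree_norm_add_le _ _).trans (max_le ?_ ?_) <;>
        rw [map_mul, map_mul, Polynomial.degree_mul, Polynomial.degree_mul]
      · exact add_le_add hab le_rfl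
      · rw [add_comm (Algebra.norm k[X] b).degree]
        exact add_le_add hcd le_rfl
  algebraMap_mem' c := by
    refine ⟨algebraMap k _ c, 1, one_ne_zero, ?_, ?_⟩
    · rw [map_one, mul_one, ← IsScalarTower.algebraMap_apply]
    · simpa using degree_norm_algebraMap_mul c (1 : W.CoordinateRing)

/-- The function `f` vanishes at infinity, as measured by the norm. -/
def SmallAtInfinity (f : W.FunctionField) : Prop :=
  ∃ a b : W.CoordinateRing, b ≠ 0 ∧ f * algebraMap _ _ b = algebraMap _ _ a ∧
    (Algebra.norm k[X] a).degree < (Algebra.norm k[X] b).degree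

lemma SmallAtInfinity.mem {f : W.FunctionField} (hf : SmallAtInfinity f) :
    f ∈ boundedAtInfinity W := by
  obtain ⟨a, b, hb, h, hab⟩ := hf
  exact ⟨a, b, hb, h, hab.le⟩

lemma SmallAtInfinity.mul {f g : W.FunctionField} (hf : SmallAtInfinity f)
    (hg : g ∈ boundedAtInfinity W) : SmallAtInfinity (f * g) := by
  obtain ⟨a, b, hb, hf, hab⟩ := hf
  obtain ⟨c, d, hd, hg, hcd⟩ := hg
  refine ⟨a * c, b * d, mul_ne_zero hb hd, ?_, ?_⟩
  · rw [map_mul, map_mul, ← hf, ← hg]; ring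
  · rw [map_mul, map_mul, Polynomial.degree_mul, Polynomial.degree_mul]
    -- For c = 0 the degree is ⊥, and adding ⊥ does not preserve a strict inequality.
    rcases eq_or_ne c 0 with rfl | hc
    · have := Module.Finite.of_basis (CoordinateRing.basis W)
      rw [Algebra.norm_zero, Polynomial.degree_zero, WithBot.add_bot, bot_lt_iff_ne_bot, Ne,
        WithBot.add_eq_bot, not_or]
      exact ⟨degree_norm_ne_bot hb, degree_norm_ne_bot hd⟩
    · exact WithBot.add_lt_add_of_lt_of_le (degree_norm_ne_bot hc) hab hcd

lemma SmallAtInfinity.add {f g : W.FunctionField} (hf : SmallAtInfinity f)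
    (hg : SmallAtInfinity g) : SmallAtInfinity (f + g) := by
  obtain ⟨a, b, hb, hf, hab⟩ := hf
  obtain ⟨c, d, hd, hg, hcd⟩ := hg
  refine ⟨a * d + c * b, b * d, mul_ne_zero hb hd, ?_, ?_⟩
  · rw [map_add, map_mul, map_mul, map_mul, ← hf, ← hg]; ring
  · refine (degree_norm_add_le _ _).trans_lt (max_lt ?_ ?_) <;>
      rw [map_mul, map_mul, Polynomial.degree_mul, Polynomial.degree_mul]
    · exact WithBot.add_lt_add_of_lt_of_le (degree_norm_ne_bot hd) hab le_rfl
    · rw [add_comm (Algebra.norm k[X] b).degree]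
      exact WithBot.add_lt_add_of_lt_of_le (degree_norm_ne_bot hb) hcd le_rfl

/-- If c = a / b then b = c⁻¹a, and scaling by a constant cannot raise the degree of the norm. So
the functions small at infinity form a proper ideal of `boundedAtInfinity`. -/
lemma not_smallAtInfinity_algebraMap {c : k} (hc : c ≠ 0) :
    ¬ SmallAtInfinity (algebraMap k W.FunctionField c) := by
  rintro ⟨a, b, hb, h, hab⟩
  have : b = algebraMap k W.CoordinateRing c⁻¹ * a := by
    apply IsFractionRing.injective W.CoordinateRing W.FunctionField
    rw [map_mul, ← h, ← IsScalarTower.algebraMap_apply, ← mul_assoc, ← map_mul,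
      inv_mul_cancel₀ hc, map_one, one_mul]
  exact absurd hab (not_lt_of_ge (this ▸ degree_norm_algebraMap_mul _ _))

lemma algHom_eq_aevalAeval {A : Type*} [CommRing A] [Algebra k A] (φ : k[X][Y] →ₐ[k] A) {x y : A}
    (hx : φ (Polynomial.C Polynomial.X) = x) (hy : φ Polynomial.X = y) :
    φ = Polynomial.aevalAeval x y := by
  subst hx hy
  exact ((Polynomial.aevalAevalEquiv k A).apply_symm_apply φ).symm

lemma algebraMap_mk_eq (F : k[X][Y]) :
    algebraMap W.CoordinateRing W.FunctionField (CoordinateRing.mk W F) =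
      F.aevalAeval W.xFun W.yFun := by
  have : ((IsScalarTower.toAlgHom k W.CoordinateRing W.FunctionField).comp
      ((AdjoinRoot.mkₐ W.polynomial).restrictScalars k)) =
      Polynomial.aevalAeval W.xFun W.yFun :=
    algHom_eq_aevalAeval _ rfl rfl
  exact DFunLike.congr_fun this F

lemma yFun_ne_zero : W.yFun ≠ 0 := by
  have := CoordinateRing.YClass_ne_zero (W' := W) 0
  rw [CoordinateRing.YClass, Polynomial.C_0, sub_zero] at this
  exact (map_ne_zero_iff _ (IsFractionRing.injective _ _)).2 this

lemma degree_norm_x : (Algebra.norm k[X] (CoordinateRing.mk W (Polynomial.C Polynomial.X))).degree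
    = 2 := by
  have := CoordinateRing.degree_norm_smul_basis (W' := W) Polynomial.X 0
  rw [zero_smul, add_zero, CoordinateRing.smul, mul_one] at this
  rw [this]
  simp

lemma degree_norm_y : (Algebra.norm k[X] (CoordinateRing.mk W Polynomial.X)).degree = 3 := by
  have := CoordinateRing.degree_norm_smul_basis (W' := W) 0 1
  rw [zero_smul, zero_add, one_smul] at this
  rw [this]
  simp

lemma mk_Y_ne_zero : CoordinateRing.mk W Polynomial.X ≠ 0 := by
  have := CoordinateRing.YClass_ne_zero (W' := W) 0
  rwa [CoordinateRing.YClass, Polynomial.C_0, sub_zero] at this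

lemma smallAtInfinity_x_div_y : SmallAtInfinity (W.xFun / W.yFun) :=
  ⟨_, _, mk_Y_ne_zero, div_mul_cancel₀ _ yFun_ne_zero, by
    rw [degree_norm_x, degree_norm_y]; norm_num⟩

lemma smallAtInfinity_one_div_y : SmallAtInfinity (1 / W.yFun) :=
  ⟨1, _, mk_Y_ne_zero, by rw [map_one]; exact div_mul_cancel₀ _ yFun_ne_zero, by
    rw [degree_norm_y]; simp⟩

lemma exists_eq_of_evalEval_eq_zero {F : k[X][Y]} {x y : k} (h : F.evalEval x y = 0) :
    ∃ A B : k[X][Y], F = Polynomial.C (Polynomial.X - Polynomial.C x) * A +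
      (Polynomial.X - Polynomial.C (Polynomial.C y)) * B := by
  have := Polynomial.mem_span_C_X_sub_C_X_sub_C_iff_eval_eval_eq_zero (a := x)
    (b := Polynomial.C y) (P := F) |>.2 h
  obtain ⟨A, B, hAB⟩ := Ideal.mem_span_pair.1 this
  exact ⟨A, B, by rw [← hAB]; ring⟩

/-- A polynomial which does not vanish at a point is nonzero as a function. -/
lemma aevalAeval_chartFun_ne_zero (P : W.Point) {G : k[X][Y]}
    (hG : G.evalEval (chartPt P).1 (chartPt P).2 ≠ 0) :
    G.aevalAeval (chartFun P).1 (chartFun P).2 ≠ 0 := by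
  rcases P with _ | ⟨x, y, hxy⟩
  -- At infinity, G is its constant term plus multiples of x/y and 1/y. Both are small with bounded
  -- cofactors, so G = 0 would make a nonzero constant small.
  · obtain ⟨A, B, hAB⟩ := exists_eq_of_evalEval_eq_zero (x := 0) (y := 0)
      (F := G - Polynomial.C (Polynomial.C (G.evalEval 0 0))) (by simp)
    have mem : ∀ F : k[X][Y],
        F.aevalAeval (W.xFun / W.yFun) (1 / W.yFun) ∈ boundedAtInfinity W := by
      intro F
      have : ((boundedAtInfinity W).val.comp (Polynomial.aevalAeval
          (⟨_, smallAtInfinity_x_div_y.mem⟩ : boundedAtInfinity W)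
          ⟨_, smallAtInfinity_one_div_y.mem⟩)) =
          Polynomial.aevalAeval (W.xFun / W.yFun) (1 / W.yFun) :=
        algHom_eq_aevalAeval _ (by simp) (by simp)
      rw [← this]
      exact Subtype.coe_prop _
    intro h0
    simp only [chartFun] at h0
    have h1 := congrArg (Polynomial.aevalAeval (W.xFun / W.yFun) (1 / W.yFun)) hAB
    simp only [map_sub, h0, map_add, map_mul, Polynomial.C_0, sub_zero,
      Polynomial.aevalAeval_X, Polynomial.aevalAeval_Y] at h1
    refine not_smallAtInfinity_algebraMap (W := W) (c := - G.evalEval 0 0) (neg_ne_zero.2 hG) ?_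
    have h2 := ((smallAtInfinity_x_div_y (W := W)).mul (mem A)).add
      (smallAtInfinity_one_div_y.mul (mem B))
    rw [← h1] at h2
    convert h2 using 1
    simp
  · intro h
    simp only [chartFun, chartPt] at h hG
    rw [← algebraMap_mk_eq, map_eq_zero_iff _ (IsFractionRing.injective _ _),
      AdjoinRoot.mk_eq_zero] at h
    have := Polynomial.evalEval_dvd x y h
    rw [hxy.1, zero_dvd_iff] at this
    exact hG this

end

section

variable {k : Type*} [Field k] {W : WeierstrassCurve.Affine k} {P : W.Point}
  {f g t u : W.FunctionField} {c d : k}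

/-! ### The local ring at a point -/

lemma hasValue_aevalAeval (P : W.Point) (F : k[X][Y]) :
    HasValue P (F.aevalAeval (chartFun P).1 (chartFun P).2)
      (F.evalEval (chartPt P).1 (chartPt P).2) :=
  ⟨F, 1, by simp, by simp, by simp⟩

lemma hasValue_algebraMap (P : W.Point) (c : k) :
    HasValue P (algebraMap k W.FunctionField c) c := by
  simpa using hasValue_aevalAeval P (Polynomial.C (Polynomial.C c))

lemma hasValue_zero (P : W.Point) : HasValue P 0 0 := by
  simpa using hasValue_algebraMap P 0

lemma hasValue_one (P : W.Point) : HasValue P 1 1 := by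
  simpa using hasValue_algebraMap P 1

lemma HasValue.add (hf : HasValue P f c) (hg : HasValue P g d) : HasValue P (f + g) (c + d) := by
  obtain ⟨F, G, hG, h, rfl⟩ := hf
  obtain ⟨F', G', hG', h', rfl⟩ := hg
  refine ⟨F * G' + F' * G, G * G', ?_, ?_, ?_⟩
  · rw [Polynomial.evalEval_mul]
    exact mul_ne_zero hG hG'
  · rw [map_mul, map_add, map_mul, map_mul, ← h, ← h']
    ring
  · rw [Polynomial.evalEval_mul, Polynomial.evalEval_add, Polynomial.evalEval_mul,
      Polynomial.evalEval_mul]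
    field_simp

lemma HasValue.mul (hf : HasValue P f c) (hg : HasValue P g d) : HasValue P (f * g) (c * d) := by
  obtain ⟨F, G, hG, h, rfl⟩ := hf
  obtain ⟨F', G', hG', h', rfl⟩ := hg
  refine ⟨F * F', G * G', ?_, ?_, ?_⟩
  · rw [Polynomial.evalEval_mul]
    exact mul_ne_zero hG hG'
  · rw [map_mul, map_mul, ← h, ← h']
    ring
  · rw [Polynomial.evalEval_mul, Polynomial.evalEval_mul]
    field_simp

lemma HasValue.neg (hf : HasValue P f c) : HasValue P (-f) (-c) := by
  simpa using (hasValue_algebraMap P (-1)).mul hf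

lemma HasValue.sub (hf : HasValue P f c) (hg : HasValue P g d) : HasValue P (f - g) (c - d) := by
  simpa only [sub_eq_add_neg] using hf.add hg.neg

lemma HasValue.pow (hf : HasValue P f c) (n : ℕ) : HasValue P (f ^ n) (c ^ n) := by
  induction n with
  | zero => simpa using hasValue_one P
  | succ n ih => simpa only [pow_succ] using ih.mul hf

/-- Cross-multiplying two representations gives a polynomial which is zero as a function, hence
vanishes at P by `aevalAeval_chartFun_ne_zero`. -/
lemma HasValue.unique (hf : HasValue P f c) (hg : HasValue P f d) : c = d := by
  obtain ⟨F, G, hG, h, rfl⟩ := hf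
  obtain ⟨F', G', hG', h', rfl⟩ := hg
  rw [div_eq_div_iff hG hG', ← sub_eq_zero, ← Polynomial.evalEval_mul, ← Polynomial.evalEval_mul,
    ← Polynomial.evalEval_sub]
  by_contra H
  apply aevalAeval_chartFun_ne_zero P H
  rw [map_sub, map_mul, map_mul, ← h, ← h']
  ring

lemma HasValue.ne_zero (hf : HasValue P f c) (hc : c ≠ 0) : f ≠ 0 := by
  rintro rfl
  exact hc (hf.unique (hasValue_zero P))

lemma HasValue.inv (hf : HasValue P f c) (hc : c ≠ 0) : HasValue P f⁻¹ c⁻¹ := by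
  have hf0 := hf.ne_zero hc
  obtain ⟨F, G, hG, h, rfl⟩ := hf
  have hF := (div_ne_zero_iff.1 hc).1
  refine ⟨G, F, hF, ?_, by rw [inv_div]⟩
  rw [← h, inv_mul_cancel_left₀ hf0]

lemma HasValue.div (hf : HasValue P f c) (hg : HasValue P g d) (hd : d ≠ 0) :
    HasValue P (f / g) (c / d) := by
  simpa only [div_eq_mul_inv] using hf.mul (hg.inv hd)

/-- A function is a uniformizer at `P` if it vanishes at `P` and divides the differences of the
coordinate functions and their values at `P`. -/
lemma isUniformizer_of_chart (ht : t ≠ 0) (ht0 : HasValue P t 0)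
    (h₁ : ∃ h c, HasValue P h c ∧
      (chartFun P).1 - algebraMap k W.FunctionField (chartPt P).1 = t * h)
    (h₂ : ∃ h c, HasValue P h c ∧
      (chartFun P).2 - algebraMap k W.FunctionField (chartPt P).2 = t * h) :
    IsUniformizer P t := by
  refine ⟨ht, ht0, fun f ⟨F, G, hG, hf, h0⟩ ↦ ?_⟩
  obtain ⟨u, a, hu, hu'⟩ := h₁
  obtain ⟨v, b, hv, hv'⟩ := h₂
  obtain ⟨A, B, hAB⟩ := exists_eq_of_evalEval_eq_zero
    ((div_eq_zero_iff.1 h0.symm).resolve_right hG)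
  have hG' := aevalAeval_chartFun_ne_zero P hG
  refine ⟨_, _, ((hu.mul (hasValue_aevalAeval P A)).add (hv.mul (hasValue_aevalAeval P B))).mul
    ((hasValue_aevalAeval P G).inv hG), ?_⟩
  have hF := congrArg (Polynomial.aevalAeval (chartFun P).1 (chartFun P).2) hAB
  have e₁ : Polynomial.aevalAeval (chartFun P).1 (chartFun P).2
      (Polynomial.C (Polynomial.X - Polynomial.C (chartPt P).1)) = t * u := by
    rw [← hu']; simp
  have e₂ : Polynomial.aevalAeval (chartFun P).1 (chartFun P).2
      (Polynomial.X - Polynomial.C (Polynomial.C (chartPt P).2)) = t * v := by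
    rw [← hv']; simp
  rw [map_add, map_mul, map_mul, e₁, e₂] at hF
  rw [eq_comm, ← mul_assoc, ← div_eq_mul_inv, div_eq_iff hG', hf, hF]
  ring

/-! ### Explicit uniformizers -/

lemma equation_xFun_yFun (W : WeierstrassCurve.Affine k) :
    W.yFun ^ 2 + algebraMap k _ W.a₁ * W.xFun * W.yFun + algebraMap k _ W.a₃ * W.yFun =
      W.xFun ^ 3 + algebraMap k _ W.a₂ * W.xFun ^ 2 + algebraMap k _ W.a₄ * W.xFun +
        algebraMap k _ W.a₆ := by
  obtain ⟨p, hp, hp'⟩ : ∃ p : k[X][Y], CoordinateRing.mk W p = 0 ∧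
      p = Polynomial.X ^ 2 + Polynomial.C (Polynomial.C W.a₁ * Polynomial.X + Polynomial.C W.a₃) *
        Polynomial.X - Polynomial.C (Polynomial.X ^ 3 + Polynomial.C W.a₂ * Polynomial.X ^ 2 +
          Polynomial.C W.a₄ * Polynomial.X + Polynomial.C W.a₆) :=
    ⟨_, AdjoinRoot.mk_self, rfl⟩
  have h := algebraMap_mk_eq (W := W) p
  rw [hp, map_zero, hp'] at h
  simp only [map_sub, map_add, map_mul, map_pow, Polynomial.aevalAeval_Y,
    Polynomial.aevalAeval_C, Polynomial.aeval_X, Polynomial.aeval_C] at h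
  linear_combination -h

lemma hasValue_xFun {x y : k} (h : W.Nonsingular x y) : HasValue (.some x y h) W.xFun x := by
  simpa [chartFun, chartPt, Polynomial.evalEval_C] using
    hasValue_aevalAeval (.some x y h : W.Point) (Polynomial.C Polynomial.X)

lemma hasValue_yFun {x y : k} (h : W.Nonsingular x y) : HasValue (.some x y h) W.yFun y := by
  simpa [chartFun, chartPt] using
    hasValue_aevalAeval (.some x y h : W.Point) Polynomial.X

lemma xFun_sub_ne_zero (x : k) : W.xFun - algebraMap k _ x ≠ 0 := by
  have h := CoordinateRing.XClass_ne_zero (W' := W) x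
  rw [CoordinateRing.XClass] at h
  have := (map_ne_zero_iff _ (IsFractionRing.injective W.CoordinateRing W.FunctionField)).2 h
  rw [algebraMap_mk_eq] at this
  simpa using this

lemma yFun_sub_ne_zero (y : k[X]) :
    W.yFun - Polynomial.aeval W.xFun y ≠ 0 := by
  have h := CoordinateRing.YClass_ne_zero (W' := W) y
  rw [CoordinateRing.YClass] at h
  have := (map_ne_zero_iff _ (IsFractionRing.injective W.CoordinateRing W.FunctionField)).2 h
  rw [algebraMap_mk_eq] at this
  simpa using this

lemma yFun_sub_const_ne_zero (y : k) : W.yFun - algebraMap k _ y ≠ 0 := by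
  simpa using yFun_sub_ne_zero (W := W) (Polynomial.C y)

/-- The cofactor of `X - x` in the product of `Y - y` and `Y - negY x y`. -/
noncomputable def cofactor (W : WeierstrassCurve.Affine k) (x : k) : W.FunctionField :=
  W.xFun ^ 2 + algebraMap k _ (x + W.a₂) * W.xFun +
    algebraMap k _ (x ^ 2 + W.a₂ * x + W.a₄) - algebraMap k _ W.a₁ * W.yFun

/-- This is the Weierstrass equation minus its instance at (x, y). Near (x, y) it expresses one of X
- x and Y - y through the other, according to which remaining factor is a unit. -/
lemma yFun_sub_mul_yFun_sub {x y : k} (h : W.Equation x y) :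
    (W.yFun - algebraMap k _ y) * (W.yFun - algebraMap k _ (W.negY x y)) =
      (W.xFun - algebraMap k _ x) * cofactor W x := by
  have h₁ := equation_xFun_yFun W
  have h₂ := congrArg (algebraMap k W.FunctionField) ((equation_iff ..).1 h)
  simp only [map_add, map_mul, map_pow] at h₂
  simp only [cofactor, negY, map_sub, map_neg, map_add, map_mul, map_pow]
  linear_combination h₁ - h₂

lemma hasValue_cofactor {x y : k} (h : W.Nonsingular x y) :
    HasValue (.some x y h) (cofactor W x) (3 * x ^ 2 + 2 * W.a₂ * x + W.a₄ - W.a₁ * y) := by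
  have hx := hasValue_xFun h
  have hy := hasValue_yFun h
  have := (((hx.pow 2).add ((hasValue_algebraMap _ (x + W.a₂)).mul hx)).add
    (hasValue_algebraMap _ (x ^ 2 + W.a₂ * x + W.a₄))).sub ((hasValue_algebraMap _ W.a₁).mul hy)
  convert! this using 1
  ring

lemma isUniformizer_xFun_sub {x y : k} (h : W.Nonsingular x y) (hy : y ≠ W.negY x y) :
    IsUniformizer (.some x y h) (W.xFun - algebraMap k _ x) := by
  have hv := (hasValue_yFun h).sub (hasValue_algebraMap _ (W.negY x y))
  have hne := sub_ne_zero.2 hy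
  refine isUniformizer_of_chart (xFun_sub_ne_zero x) ?_ ⟨1, 1, hasValue_one _, (mul_one _).symm⟩
    ⟨_, _, (hasValue_cofactor h).div hv hne, ?_⟩
  · simpa using (hasValue_xFun h).sub (hasValue_algebraMap _ x)
  · rw [← mul_div_assoc, ← yFun_sub_mul_yFun_sub h.1, mul_div_cancel_right₀ _ (hv.ne_zero hne)]
    rfl

/-- Up to sign this is the X-derivative of the Weierstrass polynomial. At a 2-torsion point the
Y-derivative vanishes, so nonsingularity forces this one to be nonzero. -/
lemma cofactor_value_ne_zero {x y : k} (h : W.Nonsingular x y) (hy : y = W.negY x y) :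
    3 * x ^ 2 + 2 * W.a₂ * x + W.a₄ - W.a₁ * y ≠ 0 := by
  rcases ((nonsingular_iff' ..).1 h).2 with h' | h'
  · intro h0; apply h'; linear_combination -h0
  · refine absurd ?_ h'
    rw [negY] at hy
    linear_combination hy

lemma isUniformizer_yFun_sub {x y : k} (h : W.Nonsingular x y) (hy : y = W.negY x y) :
    IsUniformizer (.some x y h) (W.yFun - algebraMap k _ y) := by
  have h0 : HasValue (.some x y h) (W.yFun - algebraMap k _ y) 0 := by
    simpa using (hasValue_yFun h).sub (hasValue_algebraMap _ y)
  have hc := hasValue_cofactor h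
  have hne := cofactor_value_ne_zero h hy
  refine isUniformizer_of_chart (yFun_sub_const_ne_zero y) h0 ⟨_, _, h0.div hc hne, ?_⟩
    ⟨1, 1, hasValue_one _, (mul_one _).symm⟩
  have := yFun_sub_mul_yFun_sub h.1
  rw [← hy] at this
  rw [← mul_div_assoc, this, mul_div_cancel_right₀ _ (hc.ne_zero hne)]
  rfl

lemma xFun_ne_zero : W.xFun ≠ 0 := by
  simpa using xFun_sub_ne_zero (W := W) 0

lemma hasValue_zero_x_div_y : HasValue (0 : W.Point) (W.xFun / W.yFun) 0 := by
  simpa [chartFun, chartPt, Polynomial.evalEval_C] using!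
    hasValue_aevalAeval (0 : W.Point) (Polynomial.C Polynomial.X)

lemma hasValue_zero_one_div_y : HasValue (0 : W.Point) (1 / W.yFun) 0 := by
  simpa [chartFun, chartPt] using! hasValue_aevalAeval (0 : W.Point) Polynomial.X

/-- Dividing the equation by y² writes x³/y² as 1 plus terms in x/y and 1/y, which vanish at
infinity. This unit yields the orders of x and y there. -/
lemma hasValue_zero_x_pow_div_y_pow : HasValue (0 : W.Point) (W.xFun ^ 3 / W.yFun ^ 2) 1 := by
  have hu := hasValue_zero_x_div_y (W := W)
  have hw := hasValue_zero_one_div_y (W := W)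
  have c := hasValue_algebraMap (0 : W.Point)
  have := ((((((hasValue_one _).add ((c W.a₁).mul hu)).add ((c W.a₃).mul hw)).sub
    ((c W.a₂).mul (hu.pow 2))).sub ((c W.a₄).mul (hu.mul hw))).sub ((c W.a₆).mul (hw.pow 2)))
  have h₁ := equation_xFun_yFun W
  have hy := yFun_ne_zero (W := W)
  convert this using 1
  · field_simp
    linear_combination -h₁
  · ring

lemma isUniformizer_x_div_y : IsUniformizer (0 : W.Point) (W.xFun / W.yFun) := by
  have hy := yFun_ne_zero (W := W)
  have hx := xFun_ne_zero (W := W)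
  refine isUniformizer_of_chart (div_ne_zero hx hy) hasValue_zero_x_div_y
    ⟨1, 1, hasValue_one _, ?_⟩
    -- 1/y = (x/y) · (x/y)² / (x³/y²).
    ⟨_, _, (hasValue_zero_x_div_y.pow 2).div hasValue_zero_x_pow_div_y_pow one_ne_zero, ?_⟩
  · change W.xFun / W.yFun - algebraMap k _ 0 = _
    simp
  · change 1 / W.yFun - algebraMap k _ 0 = _
    rw [map_zero]
    field_simp
    simp

lemma exists_isUniformizer (P : W.Point) : ∃ t, IsUniformizer P t := by
  rcases P with _ | ⟨x, y, h⟩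
  · exact ⟨_, isUniformizer_x_div_y⟩
  · by_cases hy : y = W.negY x y
    · exact ⟨_, isUniformizer_yFun_sub h hy⟩
    · exact ⟨_, isUniformizer_xFun_sub h hy⟩

end

section

variable {k : Type*} [Field k] {W : WeierstrassCurve.Affine k} {P : W.Point}
  {f g s t u : W.FunctionField} {c d : k} {m n : ℤ}

/-! ### Orders of vanishing -/

/-- The order of vanishing of `f` at `P` is at least `n`. -/
def OrderGE (P : W.Point) (n : ℤ) (f : W.FunctionField) : Prop :=
  ∃ (t h : W.FunctionField) (c : k), IsUniformizer P t ∧ HasValue P h c ∧ f = t ^ n * h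

lemma HasValue.zpow (hf : HasValue P f c) (hc : c ≠ 0) (n : ℤ) : HasValue P (f ^ n) (c ^ n) := by
  cases n with
  | ofNat n => simpa using hf.pow n
  | negSucc n => simpa using (hf.pow (n + 1)).inv (pow_ne_zero _ hc)

/-- Each uniformizer divides the other, so the quotient is a unit. Hence orders may be computed with
any one uniformizer. -/
lemma IsUniformizer.exists_unit (ht : IsUniformizer P t) (hs : IsUniformizer P s) :
    ∃ u c, HasValue P u c ∧ c ≠ 0 ∧ s = t * u := by
  obtain ⟨u, c, hu, rfl⟩ := ht.2.2 s hs.2.1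
  obtain ⟨v, d, hv, h⟩ := hs.2.2 t ht.2.1
  refine ⟨u, c, hu, ?_, rfl⟩
  rintro rfl
  have : u * v = 1 := by
    apply mul_left_cancel₀ ht.1
    rw [mul_one, ← mul_assoc, ← h]
  exact zero_ne_one ((zero_mul d).symm.trans ((hu.mul hv).unique (this ▸ hasValue_one P)))

lemma IsUniformizer.hasOrder_iff (ht : IsUniformizer P t) :
    HasOrder P f n ↔ ∃ u c, HasValue P u c ∧ c ≠ 0 ∧ f = t ^ n * u := by
  constructor
  · rintro ⟨s, u, c, hs, hu, hc, rfl⟩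
    obtain ⟨v, d, hv, hd, rfl⟩ := ht.exists_unit hs
    exact ⟨v ^ n * u, _, (hv.zpow hd n).mul hu, mul_ne_zero (zpow_ne_zero _ hd) hc, by
      rw [mul_zpow, mul_assoc]⟩
  · rintro ⟨u, c, hu, hc, rfl⟩
    exact ⟨t, u, c, ht, hu, hc, rfl⟩

lemma IsUniformizer.orderGE_iff (ht : IsUniformizer P t) :
    OrderGE P n f ↔ ∃ h c, HasValue P h c ∧ f = t ^ n * h := by
  constructor
  · rintro ⟨s, u, c, hs, hu, rfl⟩
    obtain ⟨v, d, hv, hd, rfl⟩ := ht.exists_unit hs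
    exact ⟨v ^ n * u, _, (hv.zpow hd n).mul hu, by rw [mul_zpow, mul_assoc]⟩
  · rintro ⟨u, c, hu, rfl⟩
    exact ⟨t, u, c, ht, hu, rfl⟩

lemma HasOrder.orderGE (h : HasOrder P f n) : OrderGE P n f := by
  obtain ⟨t, u, c, ht, hu, -, rfl⟩ := h
  exact ⟨t, u, c, ht, hu, rfl⟩

lemma HasOrder.ne_zero (h : HasOrder P f n) : f ≠ 0 := by
  obtain ⟨t, u, c, ht, hu, hc, rfl⟩ := h
  exact mul_ne_zero (zpow_ne_zero _ ht.1) (hu.ne_zero hc)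

lemma HasOrder.mul (hf : HasOrder P f m) (hg : HasOrder P g n) : HasOrder P (f * g) (m + n) := by
  obtain ⟨t, ht⟩ := exists_isUniformizer P
  rw [ht.hasOrder_iff] at *
  obtain ⟨u, c, hu, hc, rfl⟩ := hf
  obtain ⟨v, d, hv, hd, rfl⟩ := hg
  exact ⟨u * v, c * d, hu.mul hv, mul_ne_zero hc hd, by rw [zpow_add₀ ht.1]; ring⟩

lemma HasOrder.inv (hf : HasOrder P f n) : HasOrder P f⁻¹ (-n) := by
  obtain ⟨t, u, c, ht, hu, hc, rfl⟩ := hf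
  exact ⟨t, u⁻¹, c⁻¹, ht, hu.inv hc, inv_ne_zero hc, by rw [mul_inv, zpow_neg]⟩

lemma HasOrder.div (hf : HasOrder P f m) (hg : HasOrder P g n) : HasOrder P (f / g) (m - n) := by
  simpa only [div_eq_mul_inv, sub_eq_add_neg] using hf.mul hg.inv

lemma HasOrder.pow (hf : HasOrder P f n) (m : ℕ) : HasOrder P (f ^ m) (m * n) := by
  obtain ⟨t, u, c, ht, hu, hc, rfl⟩ := hf
  exact ⟨t, u ^ m, c ^ m, ht, hu.pow m, pow_ne_zero _ hc, by
    rw [mul_pow, ← zpow_natCast (t ^ n), ← zpow_mul, mul_comm n]⟩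

lemma HasValue.hasOrder (h : HasValue P f c) (hc : c ≠ 0) : HasOrder P f 0 := by
  obtain ⟨t, ht⟩ := exists_isUniformizer P
  exact ⟨t, f, c, ht, h, hc, by simp⟩

lemma HasOrder.exists_hasValue (h : HasOrder P f 0) : ∃ c, HasValue P f c ∧ c ≠ 0 := by
  obtain ⟨t, u, c, ht, hu, hc, rfl⟩ := h
  exact ⟨c, by simpa using hu, hc⟩

lemma IsUniformizer.hasOrder (ht : IsUniformizer P t) : HasOrder P t 1 :=
  ⟨t, 1, 1, ht, hasValue_one P, one_ne_zero, by simp⟩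

lemma hasOrder_algebraMap (P : W.Point) (hc : c ≠ 0) :
    HasOrder P (algebraMap k W.FunctionField c) 0 :=
  (hasValue_algebraMap P c).hasOrder hc

lemma HasOrder.algebraMap_mul (h : HasOrder P f n) (hc : c ≠ 0) :
    HasOrder P (algebraMap k W.FunctionField c * f) n := by
  simpa using (hasOrder_algebraMap P hc).mul h

lemma orderGE_zero_iff : OrderGE P 0 f ↔ ∃ c, HasValue P f c := by
  constructor
  · rintro ⟨t, u, c, ht, hu, rfl⟩
    exact ⟨c, by simpa using hu⟩
  · rintro ⟨c, h⟩
    obtain ⟨t, ht⟩ := exists_isUniformizer P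
    exact ⟨t, f, c, ht, h, by simp⟩

lemma HasValue.orderGE (h : HasValue P f c) : OrderGE P 0 f :=
  orderGE_zero_iff.2 ⟨c, h⟩

lemma orderGE_one_iff : OrderGE P 1 f ↔ HasValue P f 0 := by
  constructor
  · rintro ⟨t, u, c, ht, hu, rfl⟩
    simpa using ht.2.1.mul hu
  · intro h
    obtain ⟨t, ht⟩ := exists_isUniformizer P
    obtain ⟨u, c, hu, rfl⟩ := ht.2.2 f h
    exact ⟨t, u, c, ht, hu, by simp⟩

lemma OrderGE.mono (h : OrderGE P n f) (hmn : m ≤ n) : OrderGE P m f := by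
  obtain ⟨t, u, c, ht, hu, rfl⟩ := h
  obtain ⟨j, rfl⟩ := Int.exists_add_of_le hmn
  exact ⟨t, t ^ j * u, _, ht, (ht.2.1.pow j).mul hu, by
    rw [zpow_add₀ ht.1, zpow_natCast, mul_assoc]⟩

lemma OrderGE.add (hf : OrderGE P n f) (hg : OrderGE P n g) : OrderGE P n (f + g) := by
  obtain ⟨t, ht⟩ := exists_isUniformizer P
  rw [ht.orderGE_iff] at *
  obtain ⟨u, c, hu, rfl⟩ := hf
  obtain ⟨v, d, hv, rfl⟩ := hg
  exact ⟨u + v, c + d, hu.add hv, by ring⟩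

lemma OrderGE.mul (hf : OrderGE P m f) (hg : OrderGE P n g) : OrderGE P (m + n) (f * g) := by
  obtain ⟨t, ht⟩ := exists_isUniformizer P
  rw [ht.orderGE_iff] at *
  obtain ⟨u, c, hu, rfl⟩ := hf
  obtain ⟨v, d, hv, rfl⟩ := hg
  exact ⟨u * v, c * d, hu.mul hv, by rw [zpow_add₀ ht.1]; ring⟩

lemma OrderGE.neg (hf : OrderGE P n f) : OrderGE P n (-f) := by
  simpa using (hasValue_algebraMap P (-1)).orderGE.mul hf

lemma OrderGE.sub (hf : OrderGE P n f) (hg : OrderGE P n g) : OrderGE P n (f - g) := by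
  simpa only [sub_eq_add_neg] using hf.add hg.neg

/-- Otherwise f · f⁻¹ would vanish at P, although it has order 0. -/
lemma HasOrder.le_of_orderGE (hf : HasOrder P f n) (h : OrderGE P m f) : m ≤ n := by
  by_contra! hlt
  obtain ⟨c, hc, hc0⟩ := (show HasOrder P (f * f⁻¹) 0 by simpa using hf.mul hf.inv).exists_hasValue
  have h1 : OrderGE P 1 (f * f⁻¹) := (h.mul hf.inv.orderGE).mono (by omega)
  exact hc0 (hc.unique (orderGE_one_iff.1 h1))

lemma HasOrder.unique (hf : HasOrder P f n) (h : HasOrder P f m) : m = n :=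
  le_antisymm (hf.le_of_orderGE h.orderGE) (h.le_of_orderGE hf.orderGE)

lemma HasOrder.add_of_lt (hf : HasOrder P f n) (hg : OrderGE P m g) (h : n < m) :
    HasOrder P (f + g) n := by
  obtain ⟨t, ht⟩ := exists_isUniformizer P
  have hg' := hg.mono (show n + 1 ≤ m by omega)
  rw [ht.hasOrder_iff] at *
  rw [ht.orderGE_iff] at hg'
  obtain ⟨u, c, hu, hc, rfl⟩ := hf
  obtain ⟨v, d, hv, rfl⟩ := hg'
  refine ⟨u + t * v, c + 0 * d, hu.add (ht.2.1.mul hv), by simpa using hc, ?_⟩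
  rw [zpow_add_one₀ ht.1]
  ring

/-- If a nonzero function `w` vanishes at `β` to higher order than `v`, then `1 + w / v` takes the
value `1` at `β`. -/
lemma hasValue_one_of_lt {β : W.Point} {w : W.FunctionField} (hw : HasOrder β w m)
    (hv : HasOrder β v n) (h : n < m) : HasValue β ((v + w) / v) 1 := by
  have h₁ := orderGE_one_iff.1 ((hw.div hv).orderGE.mono (m := 1) (by omega))
  have := (hasValue_one β).add h₁
  rw [add_zero] at this
  rwa [add_div, div_self hv.ne_zero]

/-! ### Divisors -/

variable {D D' : W.Point →₀ ℤ}

lemma HasDivisor.ne_zero (h : HasDivisor f D) : f ≠ 0 :=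
  (h 0).ne_zero

lemma HasDivisor.mul (hf : HasDivisor f D) (hg : HasDivisor g D') : HasDivisor (f * g) (D + D') :=
  fun P ↦ (hf P).mul (hg P)

lemma HasDivisor.inv (hf : HasDivisor f D) : HasDivisor f⁻¹ (-D) :=
  fun P ↦ (hf P).inv

lemma HasDivisor.div (hf : HasDivisor f D) (hg : HasDivisor g D') : HasDivisor (f / g) (D - D') :=
  fun P ↦ (hf P).div (hg P)

lemma HasDivisor.algebraMap_mul (hf : HasDivisor f D) (hc : c ≠ 0) :
    HasDivisor (algebraMap k W.FunctionField c * f) D :=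
  fun P ↦ (hf P).algebraMap_mul hc

lemma hasDivisor_algebraMap (hc : c ≠ 0) :
    HasDivisor (algebraMap k W.FunctionField c) (0 : W.Point →₀ ℤ) :=
  fun P ↦ hasOrder_algebraMap P hc

lemma pt_apply [DecidableEq W.Point] (P Q : W.Point) : pt P Q = if P = Q then 1 else 0 := by
  rw [pt, Finsupp.single_apply]

lemma pt_apply_self (P : W.Point) : pt P P = 1 := by
  classical simp [pt_apply]

lemma pt_apply_of_ne {P Q : W.Point} (h : P ≠ Q) : pt P Q = 0 := by
  classical simp [pt_apply, h]

lemma pt_apply_nonneg (P Q : W.Point) : 0 ≤ pt P Q := by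
  classical
  rw [pt_apply]; split_ifs <;> simp

/-! ### Vertical lines -/

lemma hasOrder_zero_xFun : HasOrder (0 : W.Point) W.xFun (-2) := by
  refine ⟨_, _, _, isUniformizer_x_div_y, hasValue_zero_x_pow_div_y_pow, one_ne_zero, ?_⟩
  have hx := xFun_ne_zero (W := W)
  have hy := yFun_ne_zero (W := W)
  rw [zpow_neg, show (2 : ℤ) = (2 : ℕ) by rfl, zpow_natCast]
  field_simp

lemma hasOrder_zero_yFun : HasOrder (0 : W.Point) W.yFun (-3) := by
  refine ⟨_, _, _, isUniformizer_x_div_y, hasValue_zero_x_pow_div_y_pow, one_ne_zero, ?_⟩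
  have hx := xFun_ne_zero (W := W)
  have hy := yFun_ne_zero (W := W)
  rw [zpow_neg, show (3 : ℤ) = (3 : ℕ) by rfl, zpow_natCast]
  field_simp

lemma hasOrder_zero_xFun_sub (x : k) :
    HasOrder (0 : W.Point) (W.xFun - algebraMap k _ x) (-2) := by
  rw [sub_eq_add_neg, ← map_neg]
  exact hasOrder_zero_xFun.add_of_lt (hasValue_algebraMap _ _).orderGE (by norm_num)

lemma hasOrder_xFun_sub_of_Y_eq {x y : k} (h : W.Nonsingular x y) (hy : y = W.negY x y) :
    HasOrder (.some x y h) (W.xFun - algebraMap k _ x) 2 := by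
  have hc := hasValue_cofactor h
  have hne := cofactor_value_ne_zero h hy
  have := yFun_sub_mul_yFun_sub h.1
  rw [← hy] at this
  rw [← mul_div_cancel_right₀ (W.xFun - algebraMap k _ x) (hc.ne_zero hne), ← this]
  have hu := (isUniformizer_yFun_sub h hy).hasOrder
  simpa using (hu.mul hu).div (hc.hasOrder hne)

lemma eq_neg_self_iff {x y : k} (h : W.Nonsingular x y) :
    (.some x y h : W.Point) = -Point.some x y h ↔ y = W.negY x y := by
  rw [Point.neg_some, Point.some.injEq]
  simp

variable [DecidableEq k]

/-- The divisor of the vertical line through a point. -/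
lemma hasDivisor_xFun_sub {x y : k} (h : W.Nonsingular x y) :
    HasDivisor (W.xFun - algebraMap k _ x)
      (pt (.some x y h) + pt (-Point.some x y h) - pt 0 - pt 0) := by
  intro A
  rcases A with _ | ⟨x', y', h'⟩
  · have h₁ := pt_apply_of_ne (Point.some_ne_zero h)
    have h₂ := pt_apply_of_ne (neg_ne_zero.2 (Point.some_ne_zero h))
    have h₃ := pt_apply_self (0 : W.Point)
    change HasOrder (0 : W.Point) _
      ((pt (.some x y h) + pt (-Point.some x y h) - pt 0 - pt 0 : W.Point →₀ ℤ) 0)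
    simp only [Finsupp.sub_apply, Finsupp.add_apply, h₁, h₂, h₃]
    exact hasOrder_zero_xFun_sub x
  · have h₀ := pt_apply_of_ne (Point.some_ne_zero h').symm
    simp only [Finsupp.sub_apply, Finsupp.add_apply, h₀, sub_zero]
    by_cases hx : x' = x
    · have key : HasOrder (.some x' y' h') (W.xFun - algebraMap k _ x')
          ((pt (.some x' y' h') + pt (-Point.some x' y' h')) (.some x' y' h')) := by
        by_cases hy : y' = W.negY x' y'
        · rw [← (eq_neg_self_iff h').2 hy]
          simp only [Finsupp.add_apply, pt_apply_self]
          exact hasOrder_xFun_sub_of_Y_eq h' hy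
        · simp only [Finsupp.add_apply, pt_apply_self]
          rw [pt_apply_of_ne fun H ↦ hy ((eq_neg_self_iff h').1 H.symm)]
          exact (isUniformizer_xFun_sub h' hy).hasOrder
      rw [← Finsupp.add_apply, show algebraMap k W.FunctionField x = algebraMap k _ x' by rw [hx]]
      -- Equal abscissae mean that the two points agree up to sign, and the divisor is symmetric
      -- under P ↦ -P.
      rcases (Point.X_eq_iff (h₁ := h') (h₂ := h)).1 hx with H | H
      · rwa [← H]
      · rw [show (.some x y h : W.Point) = -Point.some x' y' h' by rw [H, neg_neg], neg_neg,
          add_comm]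
        exact key
    · rw [pt_apply_of_ne, pt_apply_of_ne]
      · have := (hasValue_xFun h').sub (hasValue_algebraMap _ x)
        exact this.hasOrder (sub_ne_zero.2 hx)
      · intro H
        exact hx (Point.X_eq_iff.2 (.inr H.symm))
      · intro H
        exact hx (Point.X_eq_iff.2 (.inl H.symm))

end

section

variable {k : Type*} [Field k] {W : WeierstrassCurve.Affine k} {P : W.Point}
  {f g s t u : W.FunctionField} {c d : k} {m n : ℤ}

/-! ### Lines -/

/-- The function defining the line of slope `ℓ` through `(x, y)`. -/
noncomputable def lineFun (W : WeierstrassCurve.Affine k) (x y ℓ : k) : W.FunctionField :=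
  W.yFun - algebraMap k _ y - algebraMap k _ ℓ * (W.xFun - algebraMap k _ x)

lemma hasValue_lineFun {x y x' y' : k} (ℓ : k) (h : W.Nonsingular x' y') :
    HasValue (.some x' y' h) (lineFun W x y ℓ) (y' - y - ℓ * (x' - x)) :=
  ((hasValue_yFun h).sub (hasValue_algebraMap _ y)).sub
    ((hasValue_algebraMap _ ℓ).mul ((hasValue_xFun h).sub (hasValue_algebraMap _ x)))

lemma hasOrder_zero_lineFun (x y ℓ : k) : HasOrder (0 : W.Point) (lineFun W x y ℓ) (-3) := by
  rw [lineFun, sub_sub, sub_eq_add_neg]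
  refine hasOrder_zero_yFun.add_of_lt (m := -2) (OrderGE.neg ?_) (by norm_num)
  have c := fun c ↦ (hasValue_algebraMap (0 : W.Point) c).orderGE
  refine ((c y).mono (by norm_num)).add ?_
  simpa using (c ℓ).mul (hasOrder_zero_xFun_sub x).orderGE

/-- The reflection of a line under `P ↦ -P`. -/
noncomputable def negLineFun (W : WeierstrassCurve.Affine k) (x y ℓ : k) : W.FunctionField :=
  -W.yFun - algebraMap k _ W.a₁ * W.xFun - algebraMap k _ W.a₃ - algebraMap k _ y -
    algebraMap k _ ℓ * (W.xFun - algebraMap k _ x)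

lemma hasValue_negLineFun {x y x' y' : k} (ℓ : k) (h : W.Nonsingular x' y') :
    HasValue (.some x' y' h) (negLineFun W x y ℓ) (W.negY x' y' - y - ℓ * (x' - x)) :=
  (((((hasValue_yFun h).neg.sub ((hasValue_algebraMap _ W.a₁).mul (hasValue_xFun h))).sub
    (hasValue_algebraMap _ W.a₃))).sub (hasValue_algebraMap _ y)).sub
    ((hasValue_algebraMap _ ℓ).mul ((hasValue_xFun h).sub (hasValue_algebraMap _ x)))

lemma Point.some_congr {x y x' y' : k} (h : W.Nonsingular x y) (hx : x = x') (hy : y = y') :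
    Point.some x y h = Point.some x' y' (hx ▸ hy ▸ h) := by
  subst hx hy; rfl

variable [DecidableEq k]

/-- On the curve, the product of a line and its reflection is the Weierstrass polynomial restricted
to the line: a cubic in X whose roots are the abscissae of the three intersections. -/
lemma lineFun_mul_negLineFun {x₁ x₂ y₁ y₂ : k} (h₁ : W.Equation x₁ y₁) (h₂ : W.Equation x₂ y₂)
    (hxy : ¬(x₁ = x₂ ∧ y₁ = W.negY x₂ y₂)) :
    lineFun W x₁ y₁ (W.slope x₁ x₂ y₁ y₂) * negLineFun W x₁ y₁ (W.slope x₁ x₂ y₁ y₂) =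
      -((W.xFun - algebraMap k _ x₁) * (W.xFun - algebraMap k _ x₂) *
        (W.xFun - algebraMap k _ (W.addX x₁ x₂ (W.slope x₁ x₂ y₁ y₂)))) := by
  have h := (CoordinateRing.C_addPolynomial x₁ y₁ (W.slope x₁ x₂ y₁ y₂)).symm.trans
    (CoordinateRing.C_addPolynomial_slope h₁ h₂ hxy)
  have h' := congrArg (algebraMap W.CoordinateRing W.FunctionField) h
  simp only [CoordinateRing.XClass, map_neg, map_mul (algebraMap W.CoordinateRing _),
    algebraMap_mk_eq, negPolynomial, linePolynomial, map_sub, map_add, map_mul,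
    Polynomial.aevalAeval_Y, Polynomial.aevalAeval_C, Polynomial.aeval_X, Polynomial.aeval_C] at h'
  rw [← h', lineFun, negLineFun]
  ring

lemma xFun_sub_apply {x y : k} (h : W.Nonsingular x y) (A : W.Point) (hA : A ≠ 0)
    (hA' : A ≠ -.some x y h) :
    HasOrder A (W.xFun - algebraMap k _ x) (pt (.some x y h) A) := by
  have := hasDivisor_xFun_sub h A
  simpa only [Finsupp.sub_apply, Finsupp.add_apply, pt_apply_of_ne hA.symm, sub_zero,
    pt_apply_of_ne hA'.symm, add_zero] using this

/-- The divisor of a line which meets the curve in three affine points. -/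
lemma hasDivisor_lineFun {x₁ y₁ x₂ y₂ x₃ y₃ ℓ x y : k} (h₁ : W.Nonsingular x₁ y₁)
    (h₂ : W.Nonsingular x₂ y₂) (h₃ : W.Nonsingular x₃ y₃)
    (hsum : Point.some x₁ y₁ h₁ + Point.some x₂ y₂ h₂ + Point.some x₃ y₃ h₃ = 0)
    (l₁ : y₁ - y - ℓ * (x₁ - x) = 0) (l₂ : y₂ - y - ℓ * (x₂ - x) = 0)
    (l₃ : y₃ - y - ℓ * (x₃ - x) = 0)
    (hmul : lineFun W x y ℓ * negLineFun W x y ℓ = -((W.xFun - algebraMap k _ x₁) *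
      (W.xFun - algebraMap k _ x₂) * (W.xFun - algebraMap k _ x₃))) :
    HasDivisor (lineFun W x y ℓ) (pt (.some x₁ y₁ h₁) + pt (.some x₂ y₂ h₂) +
      pt (.some x₃ y₃ h₃) - pt 0 - pt 0 - pt 0) := by
  intro A
  rcases A with _ | ⟨a, b, h⟩
  · change HasOrder (0 : W.Point) _ ((pt (.some x₁ y₁ h₁) + pt (.some x₂ y₂ h₂) +
      pt (.some x₃ y₃ h₃) - pt 0 - pt 0 - pt 0 : W.Point →₀ ℤ) 0)
    simp only [Finsupp.sub_apply, Finsupp.add_apply, pt_apply_self,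
      pt_apply_of_ne (Point.some_ne_zero _)]
    exact hasOrder_zero_lineFun x y ℓ
  have hA0 := Point.some_ne_zero h
  simp only [Finsupp.sub_apply, Finsupp.add_apply, pt_apply_of_ne hA0.symm, sub_zero]
  have hv := hasValue_lineFun (x := x) (y := y) ℓ h
  have hv' := hasValue_negLineFun (x := x) (y := y) ℓ h
  have on : ∀ {x₀ y₀ : k} (h₀ : W.Nonsingular x₀ y₀), y₀ - y - ℓ * (x₀ - x) = 0 →
      Point.some x₀ y₀ h₀ = Point.some a b h → b - y - ℓ * (a - x) = 0 := by
    intro x₀ y₀ h₀ hl H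
    rw [Point.some.injEq] at H
    rwa [← H.1, ← H.2]
  have on' : ∀ {x₀ y₀ : k} (h₀ : W.Nonsingular x₀ y₀), y₀ - y - ℓ * (x₀ - x) = 0 →
      Point.some a b h = -Point.some x₀ y₀ h₀ → W.negY a b - y - ℓ * (a - x) = 0 := by
    intro x₀ y₀ h₀ hl H
    have H' : Point.some x₀ y₀ h₀ = -Point.some a b h := by rw [H, neg_neg]
    rw [Point.neg_some, Point.some.injEq] at H'
    rwa [← H'.2, ← H'.1]
  by_cases hb : b - y - ℓ * (a - x) = 0
  · by_cases hb' : W.negY a b - y - ℓ * (a - x) = 0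
    · have hneg : b = W.negY a b := by linear_combination hb - hb'
      have hA := (eq_neg_self_iff h).2 hneg
      -- Here A is 2-torsion: Y - b is a uniformizer and X - a has order 2, so a non-vertical line
      -- meets the curve simply.
      have hord : HasOrder (.some a b h) (lineFun W x y ℓ) 1 := by
        have : lineFun W x y ℓ = (W.yFun - algebraMap k _ b) +
            algebraMap k _ (-ℓ) * (W.xFun - algebraMap k _ a) := by
          have := congrArg (algebraMap k W.FunctionField) hb
          simp only [map_sub, map_mul, map_zero] at this
          rw [lineFun, map_neg]
          linear_combination this
        rw [this]
        refine (isUniformizer_yFun_sub h hneg).hasOrder.add_of_lt (m := 2) ?_ (by norm_num)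
        simpa using (hasValue_algebraMap _ (-ℓ)).orderGE.mul
          (hasOrder_xFun_sub_of_Y_eq h hneg).orderGE
      have hprod : (a - x₁) * (a - x₂) * (a - x₃) = 0 := by
        have e := (((hasValue_xFun h).sub (hasValue_algebraMap _ x₁)).mul
          ((hasValue_xFun h).sub (hasValue_algebraMap _ x₂))).mul
          ((hasValue_xFun h).sub (hasValue_algebraMap _ x₃))
        have e' := e.neg
        rw [← hmul] at e'
        have := e'.unique (hv.mul hv')
        rw [hb, zero_mul, neg_eq_zero] at this
        exact this
      have mem : ∀ {x₀ y₀ : k} (h₀ : W.Nonsingular x₀ y₀), a - x₀ = 0 →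
          Point.some x₀ y₀ h₀ = Point.some a b h := by
        intro x₀ y₀ h₀ H
        rcases (Point.X_eq_iff (h₁ := h) (h₂ := h₀)).1 (sub_eq_zero.1 H) with H | H
        · exact H.symm
        · rw [hA, H, neg_neg]
      -- Since 2A = 0 and the three points sum to 0, A occurs only once among them: twice would
      -- force the third to be 0.
      have two : Point.some a b h + Point.some a b h = 0 := by
        nth_rewrite 1 [hA]; exact neg_add_cancel _
      rcases mul_eq_zero.1 hprod with H | H
      · rcases mul_eq_zero.1 H with H | H
        · rw [mem h₁ H] at hsum ⊢
          rw [pt_apply_self, pt_apply_of_ne, pt_apply_of_ne]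
          · exact hord
          · intro H'
            rw [H', add_right_comm, two, zero_add] at hsum
            exact Point.some_ne_zero _ hsum
          · intro H'
            rw [H', two, zero_add] at hsum
            exact Point.some_ne_zero _ hsum
        · rw [mem h₂ H] at hsum ⊢
          rw [pt_apply_self, pt_apply_of_ne, pt_apply_of_ne]
          · exact hord
          · intro H'
            rw [H', add_assoc, two, add_zero] at hsum
            exact Point.some_ne_zero _ hsum
          · intro H'
            rw [H', two, zero_add] at hsum
            exact Point.some_ne_zero _ hsum
      · rw [mem h₃ H] at hsum ⊢
        rw [pt_apply_self, pt_apply_of_ne, pt_apply_of_ne]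
        · exact hord
        · intro H'
          rw [H', add_assoc, two, add_zero] at hsum
          exact Point.some_ne_zero _ hsum
        · intro H'
          rw [H', add_right_comm, two, zero_add] at hsum
          exact Point.some_ne_zero _ hsum
    -- The reflected line is a unit at A, so the line has the order of the product of the X - xᵢ; A
    -- is the negative of none of the three points.
    · have e₁ := xFun_sub_apply h₁ _ hA0 fun H ↦ hb' (on' h₁ l₁ H)
      have e₂ := xFun_sub_apply h₂ _ hA0 fun H ↦ hb' (on' h₂ l₂ H)
      have e₃ := xFun_sub_apply h₃ _ hA0 fun H ↦ hb' (on' h₃ l₃ H)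
      have := (((e₁.mul e₂).mul e₃).algebraMap_mul (c := -1) (by simp)).div (hv'.hasOrder hb')
      rw [map_neg, map_one, neg_one_mul, ← hmul, mul_div_cancel_right₀ _ (hv'.ne_zero hb'),
        sub_zero] at this
      exact this
  · rw [pt_apply_of_ne fun H ↦ hb (on h₁ l₁ H), pt_apply_of_ne fun H ↦ hb (on h₂ l₂ H),
      pt_apply_of_ne fun H ↦ hb (on h₃ l₃ H)]
    exact hv.hasOrder hb

/-! ### The pencil of functions of degree two with poles at `0` and `e` -/

/-- A function of degree two whose polar divisor is `[0] + [e]`. -/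
noncomputable def pencilFun : W.Point → W.FunctionField
  | .zero => W.xFun
  | .some x y _ => (W.yFun - algebraMap k _ (W.negY x y)) / (W.xFun - algebraMap k _ x)

/-- For e ≠ 0, `pencilFun e` is the slope of the line joining -e to a variable point. That line
through -e and p has third point e - p; dividing by the vertical line through e cancels -e, and c is
the slope. -/
lemma exists_hasDivisor_pencilFun_sub (e : W.Point) {p : W.Point} (hp : p ≠ 0) (hpe : p ≠ e) :
    ∃ c : k, HasDivisor (pencilFun e - algebraMap k _ c) (pt p + pt (e - p) - pt 0 - pt e) := by
  rcases p with _ | ⟨x, y, h⟩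
  · exact absurd rfl hp
  rcases e with _ | ⟨x', y', h'⟩
  · refine ⟨x, ?_⟩
    change HasDivisor (W.xFun - algebraMap k _ x) (pt _ + pt (0 - Point.some x y h) - pt 0 - pt 0)
    rw [zero_sub]
    exact hasDivisor_xFun_sub h
  · have hN := (nonsingular_neg x' y').2 h'
    have hNe : Point.some x' (W.negY x' y') hN = -Point.some x' y' h' := (Point.neg_some h').symm
    set ℓ := W.slope x' x (W.negY x' y') y with hℓ
    have hxy : ¬(x' = x ∧ W.negY x' y' = W.negY x y) := by
      rintro ⟨H₁, H₂⟩
      apply hpe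
      subst H₁
      rw [Point.some.injEq]
      refine ⟨rfl, ?_⟩
      rw [← W.negY_negY x' y, ← H₂, W.negY_negY]
    have h₃ := nonsingular_negAdd hN h hxy
    have hadd : Point.some x' (W.negY x' y') hN + Point.some x y h =
        Point.some _ _ (nonsingular_add hN h hxy) := Point.add_some hxy
    have h3neg : Point.some _ _ h₃ = Point.some x' y' h' - Point.some x y h := by
      rw [← neg_sub, sub_eq_add_neg, ← hNe, add_comm, hadd, Point.neg_some]
      exact Point.some_congr _ rfl (by rw [addY, negY_negY])
    have hline := hasDivisor_lineFun (x := x') (y := W.negY x' y') (ℓ := ℓ) hN h h₃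
      (by rw [hNe, h3neg]; abel) (by ring) ?_ (by rw [negAddY]; ring)
      (lineFun_mul_negLineFun hN.1 h.1 hxy)
    · refine ⟨ℓ, ?_⟩
      have hx0 := xFun_sub_ne_zero (W := W) x'
      have heq : pencilFun (Point.some x' y' h') - algebraMap k _ ℓ =
          lineFun W x' (W.negY x' y') ℓ / (W.xFun - algebraMap k _ x') := by
        rw [pencilFun, lineFun]
        field_simp
      rw [heq]
      convert hline.div (hasDivisor_xFun_sub h') using 1
      rw [hNe, h3neg]
      abel
    -- It remains to see that p lies on the line: with equal abscissae p = -e, and otherwise the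
    -- slope is that of the chord.
    · by_cases hx : x' = x
      · have : W.negY x' y' = y := Y_eq_of_Y_ne hN.1 h.1 hx fun H ↦ hxy ⟨hx, H⟩
        rw [this, hx]; ring
      · rw [hℓ, slope_of_X_ne hx]
        have := sub_ne_zero.2 hx
        field_simp
        ring

end

section

variable {k : Type*} [Field k] {W : WeierstrassCurve.Affine k} {P : W.Point}
  {f g s t u : W.FunctionField} {c d : k} {m n : ℤ}

/-! ### Functions with prescribed poles -/

/-- Nullstellensatz: the residue field is of finite type over k, hence equal to k, and x, y are the
residues of the coordinates. -/
lemma exists_algebraMap_mk_eq [IsAlgClosed k] (M : Ideal W.CoordinateRing) [hM : M.IsMaximal] :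
    ∃ x y : k, ∀ G : k[X][Y], CoordinateRing.mk W G ∈ M ↔ G.evalEval x y = 0 := by
  let := Ideal.Quotient.field M
  have hsurj : Function.Surjective ((Ideal.Quotient.mkₐ k M).comp
      ((AdjoinRoot.mkₐ W.polynomial).restrictScalars k)) :=
    Ideal.Quotient.mk_surjective.comp AdjoinRoot.mk_surjective
  have hft : Algebra.FiniteType k k[X][Y] := Algebra.FiniteType.trans (S := k[X]) inferInstance
    inferInstance
  have : Algebra.FiniteType k (W.CoordinateRing ⧸ M) := hft.of_surjective _ hsurj
  have := finite_of_finite_type_of_isJacobsonRing k (W.CoordinateRing ⧸ M)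
  have hbij := IsAlgClosed.algebraMap_bijective_of_isIntegral (k := k)
    (K := W.CoordinateRing ⧸ M)
  set φ := (Ideal.Quotient.mkₐ k M).comp ((AdjoinRoot.mkₐ W.polynomial).restrictScalars k) with hφ
  obtain ⟨x, hx⟩ := hbij.2 (φ (Polynomial.C Polynomial.X))
  obtain ⟨y, hy⟩ := hbij.2 (φ Polynomial.X)
  refine ⟨x, y, fun G ↦ ?_⟩
  have h : φ = (Algebra.ofId k _).comp (Polynomial.aevalAeval x y) := by
    rw [algHom_eq_aevalAeval φ hx.symm hy.symm]
    refine (algHom_eq_aevalAeval _ ?_ ?_).symm <;> simp [Algebra.ofId_apply]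
  have hG : φ G = algebraMap k _ (Polynomial.aevalAeval x y G) := DFunLike.congr_fun h G
  rw [Polynomial.coe_aevalAeval_eq_evalEval] at hG
  rw [← Ideal.Quotient.eq_zero_iff_mem, ← map_eq_zero_iff _ hbij.1, ← hG]
  rfl

/-- A function which is regular at all affine points is a polynomial in the coordinates. -/
lemma exists_algebraMap_eq_of_hasValue [IsAlgClosed k] [W.IsElliptic]
    (hf : ∀ P : W.Point, P ≠ 0 → ∃ c, HasValue P f c) :
    ∃ r : W.CoordinateRing, algebraMap _ _ r = f := by
  -- The ideal of denominators of f. If proper, it would lie in the maximal ideal of some point,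
  -- where f has a nonvanishing denominator.
  let J : Ideal W.CoordinateRing :=
    { carrier := {r | ∃ s, f * algebraMap _ _ r = algebraMap W.CoordinateRing _ s}
      add_mem' := by
        rintro a b ⟨s, hs⟩ ⟨s', hs'⟩
        exact ⟨s + s', by rw [map_add, map_add, mul_add, hs, hs']⟩
      zero_mem' := ⟨0, by simp⟩
      smul_mem' := by
        rintro a b ⟨s, hs⟩
        exact ⟨a * s, by rw [smul_eq_mul, map_mul, map_mul, ← hs]; ring⟩ }
  by_cases hJ : J = ⊤
  · obtain ⟨s, hs⟩ : (1 : W.CoordinateRing) ∈ J := hJ ▸ Submodule.mem_top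
    exact ⟨s, by rw [← hs, map_one, mul_one]⟩
  · obtain ⟨M, hM, hJM⟩ := Ideal.exists_le_maximal J hJ
    obtain ⟨x, y, h⟩ := exists_algebraMap_mk_eq M
    have hE : W.Equation x y := (h W.polynomial).1 (by rw [AdjoinRoot.mk_self]; exact M.zero_mem)
    obtain ⟨c, F, G, hG, hFG, -⟩ := hf (.some x y (equation_iff_nonsingular.1 hE))
      (Point.some_ne_zero _)
    refine absurd ((h G).1 (hJM ⟨CoordinateRing.mk W F, ?_⟩)) hG
    rw [algebraMap_mk_eq, algebraMap_mk_eq]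
    exact hFG

lemma HasValue.aeval (hf : HasValue P f c) (p : k[X]) :
    HasValue P (Polynomial.aeval f p) (p.eval c) := by
  induction p using Polynomial.induction_on' with
  | add p q hp hq => simpa using hp.add hq
  | monomial n a => simpa [Polynomial.aeval_monomial] using (hasValue_algebraMap P a).mul (hf.pow n)

/-- p(x) is x ^ deg p times the reversed polynomial at 1/x, whose value at infinity is the leading
coefficient. -/
lemma hasOrder_zero_aeval_xFun {p : k[X]} (hp : p ≠ 0) :
    HasOrder (0 : W.Point) (Polynomial.aeval W.xFun p) (-2 * p.natDegree) := by
  have hx := xFun_ne_zero (W := W)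
  have := invertibleOfNonzero hx
  have hv : HasValue (0 : W.Point) (⅟W.xFun) 0 := by
    rw [invOf_eq_inv, ← orderGE_one_iff]
    exact hasOrder_zero_xFun.inv.orderGE.mono (by norm_num)
  have h := hv.aeval p.reverse
  rw [← Polynomial.coeff_zero_eq_eval_zero, Polynomial.coeff_zero_reverse] at h
  have h' := (h.hasOrder (Polynomial.leadingCoeff_ne_zero.2 hp)).mul
    (hasOrder_zero_xFun.pow p.natDegree)
  rw [Polynomial.aeval_def, Polynomial.eval₂_reverse_mul_pow] at h'
  rw [Polynomial.aeval_def]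
  convert h' using 1
  ring

/-- A function which is regular at all affine points and has at most a triple pole at infinity is
a linear combination of `1`, `x` and `y`. -/
lemma exists_eq_linear [IsAlgClosed k] [W.IsElliptic]
    (hf : ∀ P : W.Point, P ≠ 0 → ∃ c, HasValue P f c) (h0 : OrderGE (0 : W.Point) (-3) f) :
    ∃ a b c : k, f = algebraMap k _ a + algebraMap k _ b * W.xFun + algebraMap k _ c * W.yFun := by
  obtain ⟨r, rfl⟩ := exists_algebraMap_eq_of_hasValue hf
  obtain ⟨p, q, rfl⟩ := CoordinateRing.exists_smul_basis_eq r
  have key : algebraMap W.CoordinateRing W.FunctionField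
      (p • (1 : W.CoordinateRing) + q • CoordinateRing.mk W Polynomial.X) =
      Polynomial.aeval W.xFun p + Polynomial.aeval W.xFun q * W.yFun := by
    rw [CoordinateRing.smul, CoordinateRing.smul, mul_one, map_add, map_mul, algebraMap_mk_eq,
      algebraMap_mk_eq, algebraMap_mk_eq, Polynomial.aevalAeval_C, Polynomial.aevalAeval_C,
      Polynomial.aevalAeval_Y]
  rw [key] at h0 ⊢
  have hq' := fun hq : q ≠ 0 ↦ (hasOrder_zero_aeval_xFun (W := W) hq).mul hasOrder_zero_yFun
  suffices hdeg : p.natDegree ≤ 1 ∧ q.natDegree = 0 by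
    refine ⟨p.coeff 0, p.coeff 1, q.coeff 0, ?_⟩
    have hp := Polynomial.eq_X_add_C_of_natDegree_le_one hdeg.1
    have hq := Polynomial.eq_C_of_natDegree_eq_zero hdeg.2
    rw [hp, hq]
    simp
    ring
  rcases eq_or_ne p 0 with rfl | hp <;> rcases eq_or_ne q 0 with rfl | hq
  · simp
  · rw [map_zero, zero_add] at h0
    have := (hq' hq).le_of_orderGE h0
    simp only [Polynomial.natDegree_zero, zero_le, true_and]
    omega
  · rw [map_zero, zero_mul, add_zero] at h0
    have := (hasOrder_zero_aeval_xFun hp).le_of_orderGE h0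
    simp only [Polynomial.natDegree_zero, and_true]
    omega
  -- The two pole orders have different parity, so they cannot cancel.
  · rcases lt_or_gt_of_ne (show (-2 * p.natDegree : ℤ) ≠ -2 * q.natDegree + -3 by omega) with h | h
    · have := ((hasOrder_zero_aeval_xFun hp).add_of_lt (hq' hq).orderGE h).le_of_orderGE h0
      omega
    · rw [add_comm] at h0
      have := ((hq' hq).add_of_lt (hasOrder_zero_aeval_xFun hp).orderGE h).le_of_orderGE h0
      omega

lemma exists_eq_linear_xFun [IsAlgClosed k] [W.IsElliptic]
    (hf : ∀ P : W.Point, P ≠ 0 → ∃ c, HasValue P f c) (h0 : OrderGE (0 : W.Point) (-2) f) :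
    ∃ a b : k, f = algebraMap k _ a + algebraMap k _ b * W.xFun := by
  obtain ⟨a, b, c, rfl⟩ := exists_eq_linear hf (h0.mono (by norm_num))
  rcases eq_or_ne c 0 with rfl | hc
  · exact ⟨a, b, by simp⟩
  · have h₁ := (hasOrder_zero_yFun (W := W)).algebraMap_mul hc
    have h₂ : OrderGE (0 : W.Point) (-2) (algebraMap k _ a + algebraMap k _ b * W.xFun) := by
      refine ((hasValue_algebraMap _ a).orderGE.mono (by norm_num)).add ?_
      simpa using (hasValue_algebraMap _ b).orderGE.mul hasOrder_zero_xFun.orderGE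
    rw [add_comm] at h0
    have := (h₁.add_of_lt h₂ (by norm_num)).le_of_orderGE h0
    norm_num at this

/-- A function without poles is constant. -/
lemma exists_eq_algebraMap [IsAlgClosed k] [W.IsElliptic]
    (hf : ∀ P : W.Point, OrderGE P 0 f) : ∃ a : k, f = algebraMap k _ a := by
  obtain ⟨a, b, rfl⟩ := exists_eq_linear_xFun (fun P _ ↦ orderGE_zero_iff.1 (hf P))
    ((hf 0).mono (by norm_num))
  rcases eq_or_ne b 0 with rfl | hb
  · exact ⟨a, by simp⟩
  · have h₁ := (hasOrder_zero_xFun (W := W)).algebraMap_mul hb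
    have h0 := hf 0
    rw [add_comm] at h0
    have := (h₁.add_of_lt (hasValue_algebraMap _ a).orderGE (by norm_num)).le_of_orderGE h0
    norm_num at this

lemma exists_equation [IsAlgClosed k] (x : k) : ∃ y, W.Equation x y := by
  obtain ⟨y, hy⟩ := IsAlgClosed.exists_root (Polynomial.X ^ 2 +
    Polynomial.C (W.a₁ * x + W.a₃) * Polynomial.X -
      Polynomial.C (x ^ 3 + W.a₂ * x ^ 2 + W.a₄ * x + W.a₆)) (by
      have : (Polynomial.X ^ 2 + Polynomial.C (W.a₁ * x + W.a₃) * Polynomial.X -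
        Polynomial.C (x ^ 3 + W.a₂ * x ^ 2 + W.a₄ * x + W.a₆)).degree = 2 := by compute_degree!
      rw [this]; norm_num)
  refine ⟨y, (equation_iff ..).2 ?_⟩
  simp only [Polynomial.IsRoot.def, Polynomial.eval_sub, Polynomial.eval_add, Polynomial.eval_mul,
    Polynomial.eval_pow, Polynomial.eval_X, Polynomial.eval_C] at hy
  linear_combination hy

lemma exists_ne_zero_ne [IsAlgClosed k] [W.IsElliptic] (e : W.Point) :
    ∃ p : W.Point, p ≠ 0 ∧ p ≠ e := by
  rcases e with _ | ⟨x, y, h⟩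
  · obtain ⟨y, hy⟩ := exists_equation (W := W) 0
    exact ⟨.some 0 y (equation_iff_nonsingular.1 hy), Point.some_ne_zero _, Point.some_ne_zero _⟩
  · obtain ⟨y', hy⟩ := exists_equation (W := W) (x + 1)
    refine ⟨.some _ y' (equation_iff_nonsingular.1 hy), Point.some_ne_zero _, fun H ↦ ?_⟩
    rw [Point.some.injEq] at H
    simpa using H.1

variable [DecidableEq k]

/-- A function with at most simple poles at `0` and `e` is a linear combination of `1` and
`pencilFun e`. -/
lemma exists_eq_pencilFun [IsAlgClosed k] [W.IsElliptic] (e : W.Point)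
    (hf : ∀ P : W.Point, OrderGE P (-(pt 0 + pt e : W.Point →₀ ℤ) P) f) :
    ∃ a b : k, f = algebraMap k _ a + algebraMap k _ b * pencilFun e := by
  rcases e with _ | ⟨x, y, h⟩
  · refine exists_eq_linear_xFun (fun P hP ↦ ?_) ?_
    · have := hf P
      change OrderGE P (-(pt 0 + pt 0 : W.Point →₀ ℤ) P) f at this
      rw [Finsupp.add_apply, pt_apply_of_ne hP.symm] at this
      exact orderGE_zero_iff.1 this
    · have := hf 0
      change OrderGE 0 (-(pt 0 + pt 0 : W.Point →₀ ℤ) 0) f at this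
      rw [Finsupp.add_apply, pt_apply_self] at this
      exact this
  · have hN := (nonsingular_neg x y).2 h
    have hNe : -Point.some x y h = Point.some x (W.negY x y) hN := Point.neg_some h
    -- Multiplying by X - x removes the pole at e, at the price of a triple pole at 0, and forces a
    -- zero at -e. That zero fixes the constant term below.
    have hg : ∀ P : W.Point, OrderGE P (pt (Point.some x (W.negY x y) hN) P - 3 * pt 0 P)
        (f * (W.xFun - algebraMap k _ x)) := by
      intro P
      have := (hf P).mul (hasDivisor_xFun_sub h P).orderGE
      rw [hNe] at this
      convert this using 1
      simp only [Finsupp.add_apply, Finsupp.sub_apply]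
      ring
    obtain ⟨a, b, c, hbc⟩ := exists_eq_linear (f := f * (W.xFun - algebraMap k _ x))
      (fun P hP ↦ orderGE_zero_iff.1 ((hg P).mono (by
        rw [pt_apply_of_ne hP.symm]; simpa using pt_apply_nonneg _ _)))
      ((hg 0).mono (by rw [pt_apply_self]; linarith [pt_apply_nonneg (Point.some x _ hN) 0]))
    have h1 := hg (Point.some x _ hN)
    rw [pt_apply_self, pt_apply_of_ne (Point.some_ne_zero _).symm] at h1
    have h1' := orderGE_one_iff.1 h1
    rw [hbc] at h1'
    have h2 := ((((hasValue_algebraMap _ a).add ((hasValue_algebraMap _ b).mul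
      (hasValue_xFun hN))).add ((hasValue_algebraMap _ c).mul (hasValue_yFun hN)))).unique h1'
    have h3 := congrArg (algebraMap k W.FunctionField) h2
    simp only [map_add, map_mul, map_zero] at h3
    refine ⟨b, c, ?_⟩
    have hx0 := xFun_sub_ne_zero (W := W) x
    rw [pencilFun]
    apply mul_right_cancel₀ hx0
    rw [hbc, add_mul, mul_assoc, div_mul_cancel₀ _ hx0]
    linear_combination h3

/-- Every value is attained by `pencilFun e`. -/
lemma exists_hasDivisor_pencilFun_sub_const [IsAlgClosed k] [W.IsElliptic] (e : W.Point) (m : k) :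
    ∃ p : W.Point, HasDivisor (pencilFun e - algebraMap k _ m)
      (pt p + pt (e - p) - pt 0 - pt e) := by
  by_contra! H
  have hval : ∀ p : W.Point, p ≠ 0 → p ≠ e → HasOrder p (pencilFun e - algebraMap k _ m) 0 := by
    intro p hp hpe
    obtain ⟨c, hc⟩ := exists_hasDivisor_pencilFun_sub e hp hpe
    have hcm : c ≠ m := by rintro rfl; exact H p hc
    have h := (hc p).orderGE
    simp only [Finsupp.sub_apply, Finsupp.add_apply, pt_apply_self, pt_apply_of_ne hp.symm,
      pt_apply_of_ne hpe.symm] at h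
    have h' := (orderGE_one_iff.1 (h.mono (by linarith [pt_apply_nonneg (e - p) p]))).add
      (hasValue_algebraMap p (c - m))
    rw [zero_add, map_sub, sub_add_sub_cancel] at h'
    exact h'.hasOrder (sub_ne_zero.2 hcm)
  have hpole : ∀ P : W.Point, P = 0 ∨ P = e →
      ∃ n < 0, HasOrder P (pencilFun e - algebraMap k _ m) n := by
    intro P hP
    obtain ⟨p, hp, hpe⟩ := exists_ne_zero_ne e
    obtain ⟨c, hc⟩ := exists_hasDivisor_pencilFun_sub e hp hpe
    have hlt : (pt p + pt (e - p) - pt 0 - pt e : W.Point →₀ ℤ) P < 0 := by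
      have h₁ : pt p P = 0 := pt_apply_of_ne (by rcases hP with rfl | rfl <;> assumption)
      have h₂ : pt (e - p) P = 0 := by
        apply pt_apply_of_ne
        rcases hP with rfl | rfl
        · exact sub_ne_zero.2 hpe.symm
        · rwa [Ne, sub_eq_self]
      simp only [Finsupp.sub_apply, Finsupp.add_apply, h₁, h₂]
      rcases hP with rfl | rfl
      · linarith [pt_apply_self (0 : W.Point), pt_apply_nonneg e 0]
      · linarith [pt_apply_self P, pt_apply_nonneg 0 P]
    refine ⟨_, hlt, ?_⟩
    have := (hc P).add_of_lt (hasValue_algebraMap P (c - m)).orderGE hlt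
    rwa [map_sub, sub_add_sub_cancel] at this
  -- If m is not attained, the inverse has no poles and is constant, contradicting the pole of
  -- `pencilFun e - m` at 0.
  obtain ⟨a, ha⟩ := exists_eq_algebraMap (f := (pencilFun e - algebraMap k _ m)⁻¹) fun P ↦ by
    by_cases hP : P = 0 ∨ P = e
    · obtain ⟨n, hn, h⟩ := hpole P hP
      exact h.inv.orderGE.mono (by omega)
    · rw [not_or] at hP
      exact (hval P hP.1 hP.2).inv.orderGE.mono (by norm_num)
  obtain ⟨n, hn, h⟩ := hpole 0 (.inl rfl)
  have h' := h.orderGE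
  rw [← inv_inv (pencilFun e - _), ha, ← map_inv₀] at h
  have := h.le_of_orderGE (hasValue_algebraMap _ _).orderGE
  omega

/-- The relation between points in a sum, as a function. -/
lemma exists_hasDivisor_add (P Q : W.Point) :
    ∃ h : W.FunctionField, HasDivisor h (pt P + pt Q - pt 0 - pt (P + Q)) := by
  rcases eq_or_ne P 0 with rfl | hP
  · exact ⟨algebraMap k _ 1, by simpa using hasDivisor_algebraMap (W := W) one_ne_zero⟩
  rcases eq_or_ne Q 0 with rfl | hQ
  · exact ⟨algebraMap k _ 1, by simpa using hasDivisor_algebraMap (W := W) one_ne_zero⟩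
  obtain ⟨c, hc⟩ := exists_hasDivisor_pencilFun_sub (P + Q) hP (by rwa [Ne, left_eq_add])
  exact ⟨_, by simpa using hc⟩

end

section

variable {k : Type*} [Field k] {W : WeierstrassCurve.Affine k} {P : W.Point}
  {f g s t u v : W.FunctionField} {c d : k} {m n : ℤ} [DecidableEq k]

/-! ### Pencils of degree two with arbitrary poles -/

/-- `u` is a function of degree two with polar divisor `[γ₁] + [γ₂]`: its fibres are the pairs of
points with the same sum as `γ₁` and `γ₂`. -/
def IsPencil (γ₁ γ₂ : W.Point) (u : W.FunctionField) : Prop :=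
  ∀ p : W.Point, p ≠ γ₁ → p ≠ γ₂ → ∃ c : k,
    HasDivisor (u - algebraMap k _ c) (pt p + pt (γ₁ + γ₂ - p) - pt γ₁ - pt γ₂)

/-- When neither point is 0, they form a fibre of `pencilFun (γ₁ + γ₂)`; inverting moves this fibre
to the poles, and the old poles become the fibre over 0. -/
lemma exists_isPencil (γ₁ γ₂ : W.Point) : ∃ u : W.FunctionField, IsPencil γ₁ γ₂ u := by
  by_cases h₀ : γ₁ = 0
  · refine ⟨pencilFun γ₂, fun p h₁ h₂ ↦ ?_⟩
    subst h₀
    rw [zero_add]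
    exact exists_hasDivisor_pencilFun_sub γ₂ h₁ h₂
  by_cases h₀' : γ₂ = 0
  · refine ⟨pencilFun γ₁, fun p h₁ h₂ ↦ ?_⟩
    subst h₀'
    rw [add_zero, sub_right_comm]
    exact exists_hasDivisor_pencilFun_sub γ₁ h₂ h₁
  obtain ⟨c₁, hc₁⟩ := exists_hasDivisor_pencilFun_sub (γ₁ + γ₂) h₀ (by rwa [Ne, left_eq_add])
  rw [add_sub_cancel_left] at hc₁
  refine ⟨(pencilFun (γ₁ + γ₂) - algebraMap k _ c₁)⁻¹, fun p h₁ h₂ ↦ ?_⟩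
  by_cases hp : p = 0 ∨ p = γ₁ + γ₂
  · refine ⟨0, ?_⟩
    rw [map_zero, sub_zero]
    convert hc₁.inv using 1
    rcases hp with rfl | rfl
    · rw [sub_zero]; abel
    · rw [sub_self]; abel
  · rw [not_or] at hp
    obtain ⟨c, hc⟩ := exists_hasDivisor_pencilFun_sub (γ₁ + γ₂) hp.1 hp.2
    have hne : c ≠ c₁ := by
      rintro rfl
      have := (hc p).unique (hc₁ p)
      simp only [Finsupp.sub_apply, Finsupp.add_apply, pt_apply_self, pt_apply_of_ne h₁.symm,
        pt_apply_of_ne h₂.symm] at this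
      linarith [pt_apply_nonneg (γ₁ + γ₂ - p) p]
    -- 1/(F - c₁) - 1/(c - c₁) = -(c - c₁)⁻¹ (F - c)/(F - c₁).
    refine ⟨(c - c₁)⁻¹, ?_⟩
    have hd := (hc.div hc₁).algebraMap_mul (neg_ne_zero.2 (inv_ne_zero (sub_ne_zero.2 hne)))
    convert hd using 1
    · have h₃ : algebraMap k W.FunctionField c - algebraMap k _ c₁ ≠ 0 := by
        rw [← map_sub]
        exact (map_ne_zero _).2 (sub_ne_zero.2 hne)
      have h₄ := hc₁.ne_zero
      rw [map_neg, map_inv₀, map_sub]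
      field_simp
      ring
    · abel

variable {γ₁ γ₂ p q : W.Point}

lemma IsPencil.affine (hu : IsPencil γ₁ γ₂ u) (hc : c ≠ 0) (d : k) :
    IsPencil γ₁ γ₂ (algebraMap k _ c * u + algebraMap k _ d) := by
  intro p h₁ h₂
  obtain ⟨a, ha⟩ := hu p h₁ h₂
  refine ⟨c * a + d, ?_⟩
  convert ha.algebraMap_mul hc using 1
  rw [map_add, map_mul]
  ring

lemma IsPencil.exists_hasValue (hu : IsPencil γ₁ γ₂ u) (h₁ : p ≠ γ₁) (h₂ : p ≠ γ₂) :
    ∃ c : k, HasValue p u c := by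
  obtain ⟨c, hc⟩ := hu p h₁ h₂
  have h := (hc p).orderGE
  simp only [Finsupp.sub_apply, Finsupp.add_apply, pt_apply_self, pt_apply_of_ne h₁.symm,
    pt_apply_of_ne h₂.symm] at h
  have h' := (orderGE_one_iff.1 (h.mono (by linarith [pt_apply_nonneg (γ₁ + γ₂ - p) p]))).add
    (hasValue_algebraMap p c)
  rw [zero_add, sub_add_cancel] at h'
  exact ⟨c, h'⟩

lemma IsPencil.hasDivisor (hu : IsPencil γ₁ γ₂ u) (h₁ : p ≠ γ₁) (h₂ : p ≠ γ₂)
    (hc : HasValue p u c) :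
    HasDivisor (u - algebraMap k _ c) (pt p + pt (γ₁ + γ₂ - p) - pt γ₁ - pt γ₂) := by
  obtain ⟨d, hd⟩ := hu p h₁ h₂
  have h := (hd p).orderGE
  simp only [Finsupp.sub_apply, Finsupp.add_apply, pt_apply_self, pt_apply_of_ne h₁.symm,
    pt_apply_of_ne h₂.symm] at h
  have h' := orderGE_one_iff.1 (h.mono (m := 1) (by linarith [pt_apply_nonneg (γ₁ + γ₂ - p) p]))
  have := (hc.sub (hasValue_algebraMap p d)).unique h'
  rwa [sub_eq_zero.1 this]

/-- The fibre through p is {p, γ₁ + γ₂ - p}, and q is neither point. -/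
lemma IsPencil.value_ne (hu : IsPencil γ₁ γ₂ u) (h₁ : p ≠ γ₁) (h₂ : p ≠ γ₂) (h₃ : q ≠ γ₁)
    (h₄ : q ≠ γ₂) (hpq : p ≠ q) (hsum : p + q ≠ γ₁ + γ₂) (hc : HasValue p u c)
    (hd : HasValue q u d) : c ≠ d := by
  rintro rfl
  have h := hu.hasDivisor h₁ h₂ hc q
  simp only [Finsupp.sub_apply, Finsupp.add_apply, pt_apply_of_ne h₃.symm,
    pt_apply_of_ne h₄.symm, pt_apply_of_ne hpq] at h
  rw [pt_apply_of_ne fun H ↦ hsum (by rw [← H]; abel)] at h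
  obtain ⟨a, ha, ha'⟩ := HasOrder.exists_hasValue (by simpa using h)
  apply ha'
  have := ha.unique (hd.sub (hasValue_algebraMap q c))
  rwa [sub_self] at this

lemma IsPencil.hasOrder_pole [IsAlgClosed k] (hu : IsPencil γ₁ γ₂ u) (hp₁ : p ≠ γ₁) (hp₂ : p ≠ γ₂)
    (hP : P = γ₁ ∨ P = γ₂) : HasOrder P u (-(pt γ₁ + pt γ₂ : W.Point →₀ ℤ) P) := by
  obtain ⟨c, hc⟩ := hu p hp₁ hp₂
  have h := hc P
  have h₁ : pt p P = 0 := pt_apply_of_ne (by rcases hP with rfl | rfl <;> assumption)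
  have h₂ : pt (γ₁ + γ₂ - p) P = 0 := by
    apply pt_apply_of_ne
    rcases hP with rfl | rfl
    · rw [add_sub_assoc, Ne, add_eq_left, sub_eq_zero]; exact hp₂.symm
    · rw [add_sub_right_comm, Ne, add_eq_right, sub_eq_zero]; exact hp₁.symm
  have hlt : -(pt γ₁ + pt γ₂ : W.Point →₀ ℤ) P < 0 := by
    rw [Finsupp.add_apply]
    rcases hP with rfl | rfl
    · linarith [pt_apply_self P, pt_apply_nonneg γ₂ P]
    · linarith [pt_apply_self P, pt_apply_nonneg γ₁ P]
  simp only [Finsupp.sub_apply, Finsupp.add_apply, h₁, h₂] at h hlt ⊢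
  have := (h.add_of_lt (hasValue_algebraMap P c).orderGE (by linarith))
  rw [sub_add_cancel] at this
  convert this using 1
  ring

lemma IsPencil.orderGE [IsAlgClosed k] (hu : IsPencil γ₁ γ₂ u) (hp₁ : p ≠ γ₁) (hp₂ : p ≠ γ₂)
    (P : W.Point) : OrderGE P (-(pt γ₁ + pt γ₂ : W.Point →₀ ℤ) P) u := by
  by_cases hP : P = γ₁ ∨ P = γ₂
  · exact (hu.hasOrder_pole hp₁ hp₂ hP).orderGE
  · rw [not_or] at hP
    obtain ⟨c, hc⟩ := hu.exists_hasValue hP.1 hP.2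
    rw [Finsupp.add_apply, pt_apply_of_ne (Ne.symm hP.1), pt_apply_of_ne (Ne.symm hP.2)]
    exact hc.orderGE

/-! ### The divisor of a difference of two pencils -/

/-- A function with at most four given poles and two given zeros has two more zeros. -/
lemma exists_hasDivisor_of_orderGE [IsAlgClosed k] [W.IsElliptic] {α₁ α₂ β₁ β₂ γ₁ γ₂ : W.Point}
    (hf : f ≠ 0) (h : ∀ P : W.Point, OrderGE P
      ((pt β₁ + pt β₂ - (pt α₁ + pt α₂) - (pt γ₁ + pt γ₂) : W.Point →₀ ℤ) P) f) :
    ∃ p p' : W.Point, HasDivisor f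
      (pt β₁ + pt β₂ + pt p + pt p' - (pt α₁ + pt α₂) - (pt γ₁ + pt γ₂)) := by
  obtain ⟨hα, dα⟩ := exists_hasDivisor_add α₁ α₂
  obtain ⟨hβ, dβ⟩ := exists_hasDivisor_add β₁ β₂
  obtain ⟨hγ, dγ⟩ := exists_hasDivisor_add γ₁ γ₂
  -- With this e the product `q` below has divisor [β₁]+[β₂]+[0]+[e]-[α₁]-[α₂]-[γ₁]-[γ₂], so f/q
  -- lies in L([0]+[e]).
  set e := α₁ + α₂ + (γ₁ + γ₂) - (β₁ + β₂) with he
  obtain ⟨r, dr⟩ := exists_hasDivisor_add e (β₁ + β₂)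
  obtain ⟨s, ds⟩ := exists_hasDivisor_add (α₁ + α₂) (γ₁ + γ₂)
  rw [show e + (β₁ + β₂) = α₁ + α₂ + (γ₁ + γ₂) by rw [he]; abel] at dr
  have dq := ((dβ.mul dr).div ((dα.mul dγ).mul ds))
  set q := hβ * r / (hα * hγ * s)
  have hfq : ∀ P : W.Point, OrderGE P (-(pt 0 + pt e : W.Point →₀ ℤ) P) (f / q) := by
    intro P
    rw [div_eq_mul_inv]
    convert (h P).mul (dq P).inv.orderGE using 1
    simp only [Finsupp.sub_apply, Finsupp.add_apply]
    ring
  obtain ⟨a, b, hab⟩ := exists_eq_pencilFun e hfq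
  have hfe : f = (algebraMap k _ a + algebraMap k _ b * pencilFun e) * q := by
    rw [← hab, div_mul_cancel₀ _ dq.ne_zero]
  rcases eq_or_ne b 0 with rfl | hb
  · rw [map_zero, zero_mul, add_zero] at hfe
    have ha : a ≠ 0 := by rintro rfl; simp [hf] at hfe
    refine ⟨0, e, ?_⟩
    rw [hfe]
    convert dq.algebraMap_mul ha using 1
    abel
  · obtain ⟨p, hp⟩ := exists_hasDivisor_pencilFun_sub_const e (-(a / b))
    refine ⟨p, e - p, ?_⟩
    convert (hp.algebraMap_mul hb).mul dq using 1
    · rw [hfe]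
      have : algebraMap k W.FunctionField b ≠ 0 := (map_ne_zero _).2 hb
      rw [map_neg, map_div₀]
      field_simp
      ring
    · abel

/-- Disjointness prevents cancellation, so the positive part is exactly the three listed zeros. -/
lemma sum_toNat_eq_three {α₁ α₂ α' γ₁ γ₂ γ' : W.Point}
    (h : Disjoint ({α₁, α₂, α'} : Set W.Point) {γ₁, γ₂, γ'}) :
    (pt α₁ + pt α₂ + pt α' - pt γ₁ - pt γ₂ - pt γ').sum (fun _ m => m.toNat) = 3 := by
  classical
  set D := pt α₁ + pt α₂ + pt α' - pt γ₁ - pt γ₂ - pt γ' with hD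
  set S : Finset W.Point := D.support ∪ {α₁, α₂, α'} with hS
  rw [Finsupp.sum_of_support_subset D (s := S) Finset.subset_union_left _ (by simp)]
  have hpos : ∀ P ∈ S, (D P).toNat = ((pt α₁ P + pt α₂ P + pt α' P).toNat) := by
    intro P _
    rw [hD]
    simp only [Finsupp.sub_apply, Finsupp.add_apply]
    by_cases hP : P ∈ ({α₁, α₂, α'} : Set W.Point)
    · have := Set.disjoint_left.1 h hP
      simp only [Set.mem_insert_iff, Set.mem_singleton_iff, not_or] at this
      rw [pt_apply_of_ne (Ne.symm this.1), pt_apply_of_ne (Ne.symm this.2.1),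
        pt_apply_of_ne (Ne.symm this.2.2)]
      simp
    · simp only [Set.mem_insert_iff, Set.mem_singleton_iff, not_or] at hP
      rw [pt_apply_of_ne (Ne.symm hP.1), pt_apply_of_ne (Ne.symm hP.2.1),
        pt_apply_of_ne (Ne.symm hP.2.2)]
      have h₁ := pt_apply_nonneg γ₁ P
      have h₂ := pt_apply_nonneg γ₂ P
      have h₃ := pt_apply_nonneg γ' P
      omega
  rw [Finset.sum_congr rfl hpos]
  zify
  have hnn : ∀ P ∈ S, ((pt α₁ P + pt α₂ P + pt α' P).toNat : ℤ) =
      pt α₁ P + pt α₂ P + pt α' P := fun P _ ↦ Int.toNat_of_nonneg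
    (add_nonneg (add_nonneg (pt_apply_nonneg _ _) (pt_apply_nonneg _ _)) (pt_apply_nonneg _ _))
  rw [Finset.sum_congr rfl hnn, Finset.sum_add_distrib, Finset.sum_add_distrib]
  have hone : ∀ A ∈ S, ∑ P ∈ S, pt A P = 1 := by
    intro A hA
    simp only [pt_apply, Finset.sum_ite_eq, hA, if_true]
  rw [hone α₁ (by simp [hS]), hone α₂ (by simp [hS]), hone α' (by simp [hS])]
  norm_num

/-- Two pencils with disjoint polar divisors and different sums, which take the same values at two
points `β₁` and `β₂`, have proportional fibres through a common point. -/
lemma exists_ratio_of_isPencil [IsAlgClosed k] [W.IsElliptic] {α₁ α₂ β₁ β₂ γ₁ γ₂ : W.Point}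
    (hαβ : Disjoint ({α₁, α₂} : Set W.Point) {β₁, β₂})
    (hβγ : Disjoint ({β₁, β₂} : Set W.Point) {γ₁, γ₂})
    (hαγ : Disjoint ({α₁, α₂} : Set W.Point) {γ₁, γ₂}) (hβ : β₁ ≠ β₂)
    (sαγ : α₁ + α₂ ≠ γ₁ + γ₂) (hu : IsPencil γ₁ γ₂ u) (hv : IsPencil α₁ α₂ v)
    (hβ₁ : HasValue β₁ (u - v) 0) (hβ₂ : HasValue β₂ (u - v) 0) :
    ∃ g : W.FunctionField, HasValue β₁ g 1 ∧ HasValue β₂ g 1 ∧ ∃ α' γ' : W.Point,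
      Disjoint ({α₁, α₂, α'} : Set W.Point) {γ₁, γ₂, γ'} ∧
      HasDivisor g (pt α₁ + pt α₂ + pt α' - pt γ₁ - pt γ₂ - pt γ') := by
  simp only [Set.disjoint_insert_left, Set.disjoint_singleton_left, Set.mem_insert_iff,
    Set.mem_singleton_iff, not_or] at hαβ hβγ hαγ
  obtain ⟨⟨a₁b₁, a₁b₂⟩, a₂b₁, a₂b₂⟩ := hαβ
  obtain ⟨⟨b₁c₁, b₁c₂⟩, b₂c₁, b₂c₂⟩ := hβγ
  obtain ⟨⟨a₁c₁, a₁c₂⟩, a₂c₁, a₂c₂⟩ := hαγ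
  have hvp := hv.orderGE (Ne.symm a₁b₁) (Ne.symm a₂b₁)
  have hup := hu.orderGE b₁c₁ b₁c₂
  have pole_u : ∀ P, P = γ₁ ∨ P = γ₂ →
      HasOrder P (u - v) (-(pt γ₁ + pt γ₂ : W.Point →₀ ℤ) P) := by
    intro P hP
    obtain ⟨c, hc⟩ := hv.exists_hasValue (p := P)
      (by rcases hP with rfl | rfl <;> exact Ne.symm ‹_›)
      (by rcases hP with rfl | rfl <;> exact Ne.symm ‹_›)
    rw [sub_eq_add_neg]
    refine (hu.hasOrder_pole b₁c₁ b₁c₂ hP).add_of_lt hc.orderGE.neg ?_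
    rw [Finsupp.add_apply]
    rcases hP with rfl | rfl
    · linarith [pt_apply_self P, pt_apply_nonneg γ₂ P]
    · linarith [pt_apply_self P, pt_apply_nonneg γ₁ P]
  have pole_v : ∀ P, P = α₁ ∨ P = α₂ →
      HasOrder P (u - v) (-(pt α₁ + pt α₂ : W.Point →₀ ℤ) P) := by
    intro P hP
    obtain ⟨c, hc⟩ := hu.exists_hasValue (p := P)
      (by rcases hP with rfl | rfl <;> assumption) (by rcases hP with rfl | rfl <;> assumption)
    have h := ((hv.hasOrder_pole (Ne.symm a₁b₁) (Ne.symm a₂b₁) hP).algebraMap_mul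
      (c := -1) (by simp)).add_of_lt hc.orderGE (by
        rw [Finsupp.add_apply]
        rcases hP with rfl | rfl
        · linarith [pt_apply_self P, pt_apply_nonneg α₂ P]
        · linarith [pt_apply_self P, pt_apply_nonneg α₁ P])
    rw [map_neg, map_one, neg_one_mul, neg_add_eq_sub] at h
    exact h
  have hw : ∀ P : W.Point, OrderGE P
      ((pt β₁ + pt β₂ - (pt α₁ + pt α₂) - (pt γ₁ + pt γ₂) : W.Point →₀ ℤ) P) (u - v) := by
    intro P
    by_cases h₁ : P = β₁
    · subst h₁
      simp only [Finsupp.sub_apply, Finsupp.add_apply, pt_apply_self, pt_apply_of_ne hβ.symm,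
        pt_apply_of_ne a₁b₁, pt_apply_of_ne a₂b₁, pt_apply_of_ne (Ne.symm b₁c₁),
        pt_apply_of_ne (Ne.symm b₁c₂)]
      exact orderGE_one_iff.2 hβ₁
    by_cases h₂ : P = β₂
    · subst h₂
      simp only [Finsupp.sub_apply, Finsupp.add_apply, pt_apply_self, pt_apply_of_ne hβ,
        pt_apply_of_ne a₁b₂, pt_apply_of_ne a₂b₂, pt_apply_of_ne (Ne.symm b₂c₁),
        pt_apply_of_ne (Ne.symm b₂c₂)]
      exact orderGE_one_iff.2 hβ₂
    have e₁ := pt_apply_nonneg α₁ P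
    have e₂ := pt_apply_nonneg α₂ P
    have e₃ := pt_apply_nonneg γ₁ P
    have e₄ := pt_apply_nonneg γ₂ P
    refine ((hup P).mono ?_).sub ((hvp P).mono ?_) <;>
    · simp only [Finsupp.sub_apply, Finsupp.add_apply, pt_apply_of_ne (Ne.symm h₁),
        pt_apply_of_ne (Ne.symm h₂)]
      linarith
  obtain ⟨p, p', hp⟩ := exists_hasDivisor_of_orderGE (pole_u γ₁ (.inl rfl)).ne_zero hw
  -- The other pencil is regular at P, so u - v keeps the full pole there; an extra zero at P would
  -- lower it.
  have hpγ : ∀ P, P = γ₁ ∨ P = γ₂ → p ≠ P := by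
    intro P hP hpP
    have := (hp P).unique (pole_u P hP)
    simp only [Finsupp.sub_apply, Finsupp.add_apply] at this
    rw [pt_apply_of_ne (P := α₁), pt_apply_of_ne (P := α₂), hpP, pt_apply_self] at this
    · linarith [pt_apply_nonneg β₁ P, pt_apply_nonneg β₂ P, pt_apply_nonneg p' P]
    all_goals rcases hP with rfl | rfl <;> assumption
  have hpα : ∀ P, P = α₁ ∨ P = α₂ → p ≠ P := by
    intro P hP hpP
    have := (hp P).unique (pole_v P hP)
    simp only [Finsupp.sub_apply, Finsupp.add_apply] at this
    rw [pt_apply_of_ne (P := γ₁), pt_apply_of_ne (P := γ₂), hpP, pt_apply_self] at this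
    · linarith [pt_apply_nonneg β₁ P, pt_apply_nonneg β₂ P, pt_apply_nonneg p' P]
    all_goals rcases hP with rfl | rfl <;> exact Ne.symm ‹_›
  have pc₁ := hpγ γ₁ (.inl rfl)
  have pc₂ := hpγ γ₂ (.inr rfl)
  have pa₁ := hpα α₁ (.inl rfl)
  have pa₂ := hpα α₂ (.inr rfl)
  obtain ⟨c, hc⟩ := hu.exists_hasValue pc₁ pc₂
  obtain ⟨d, hd⟩ := hv.exists_hasValue pa₁ pa₂
  have hcd : c = d := by
    have h := (hp p).orderGE
    simp only [Finsupp.sub_apply, Finsupp.add_apply, pt_apply_self, pt_apply_of_ne (Ne.symm pc₁),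
      pt_apply_of_ne (Ne.symm pc₂), pt_apply_of_ne (Ne.symm pa₁),
      pt_apply_of_ne (Ne.symm pa₂)] at h
    have h' := orderGE_one_iff.1 (h.mono (m := 1) (by
      linarith [pt_apply_nonneg β₁ p, pt_apply_nonneg β₂ p, pt_apply_nonneg p' p]))
    exact sub_eq_zero.1 ((hc.sub hd).unique h')
  subst hcd
  have du := hu.hasDivisor pc₁ pc₂ hc
  have dv := hv.hasDivisor pa₁ pa₂ hd
  have value : ∀ β, β ≠ α₁ → β ≠ α₂ → β ≠ γ₁ → β ≠ γ₂ →
      (1 ≤ pt β₁ β + pt β₂ β) →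
      HasValue β ((u - algebraMap k _ c) / (v - algebraMap k _ c)) 1 := by
    intro β ha₁ ha₂ hc₁ hc₂ h1
    have hwβ := hp β
    have huβ := du β
    have hvβ := dv β
    simp only [Finsupp.sub_apply, Finsupp.add_apply, pt_apply_of_ne ha₁.symm,
      pt_apply_of_ne ha₂.symm, pt_apply_of_ne hc₁.symm, pt_apply_of_ne hc₂.symm]
      at hwβ huβ hvβ
    have hp' := pt_apply_nonneg p' β
    -- If β ≠ α₁+α₂-p, then u - v vanishes to higher order at β than v - c. Otherwise β ≠ γ₁+γ₂-p,
    -- as the sums differ, and u - c takes that role.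
    by_cases hβp : β = α₁ + α₂ - p
    · rw [pt_apply_of_ne (P := γ₁ + γ₂ - p) fun H ↦
        sαγ (sub_left_injective (hβp.symm.trans H.symm))] at huβ
      have := (hasValue_one_of_lt (hwβ.algebraMap_mul (c := -1) (by simp)) huβ (by linarith)).inv
        one_ne_zero
      rw [map_neg, map_one, neg_one_mul, inv_div, inv_one] at this
      convert this using 2
      ring
    · rw [pt_apply_of_ne (P := α₁ + α₂ - p) (Ne.symm hβp)] at hvβ
      have := hasValue_one_of_lt hwβ hvβ (by linarith)
      convert this using 2
      ring
  refine ⟨(u - algebraMap k _ c) / (v - algebraMap k _ c),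
    value β₁ (Ne.symm a₁b₁) (Ne.symm a₂b₁) b₁c₁ b₁c₂ ?_,
    value β₂ (Ne.symm a₁b₂) (Ne.symm a₂b₂) b₂c₁ b₂c₂ ?_,
    γ₁ + γ₂ - p, α₁ + α₂ - p, ?_, ?_⟩
  · rw [pt_apply_self]; linarith [pt_apply_nonneg β₂ β₁]
  · rw [pt_apply_self]; linarith [pt_apply_nonneg β₁ β₂]
  · simp only [Set.disjoint_insert_left, Set.disjoint_singleton_left, Set.mem_insert_iff,
      Set.mem_singleton_iff, not_or]
    refine ⟨⟨a₁c₁, a₁c₂, ?_⟩, ⟨a₂c₁, a₂c₂, ?_⟩, ?_, ?_, ?_⟩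
    · rw [add_sub_assoc, left_eq_add, sub_eq_zero]; exact Ne.symm pa₂
    · rw [add_sub_right_comm, right_eq_add, sub_eq_zero]; exact Ne.symm pa₁
    · rw [add_sub_assoc, add_eq_left, sub_eq_zero]; exact Ne.symm pc₂
    · rw [add_sub_right_comm, add_eq_right, sub_eq_zero]; exact Ne.symm pc₁
    · exact fun H ↦ sαγ (sub_left_injective H.symm)
  · convert du.div dv using 1
    abel

end

end WeierstrassCurve.Affine

/-! ### The main theorem -/

open WeierstrassCurve.Affine in
theorem mainTheorem7 {k : Type*} [Field k] [IsAlgClosed k] [CharZero k] [DecidableEq k]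
    (E : WeierstrassCurve k) [E.IsElliptic]
    (α₁ α₂ β₁ β₂ γ₁ γ₂ : E.toAffine.Point)
    (hαβ : Disjoint ({α₁, α₂} : Set E.toAffine.Point) {β₁, β₂})
    (hβγ : Disjoint ({β₁, β₂} : Set E.toAffine.Point) {γ₁, γ₂})
    (hαγ : Disjoint ({α₁, α₂} : Set E.toAffine.Point) {γ₁, γ₂})
    (hβ : β₁ ≠ β₂)
    (h₁ : α₁ + α₂ - γ₁ - β₁ ≠ 0)
    (h₂ : α₁ + α₂ - γ₁ - β₂ ≠ 0)
    (sαβ : α₁ + α₂ ≠ β₁ + β₂)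
    (sβγ : β₁ + β₂ ≠ γ₁ + γ₂)
    (sαγ : α₁ + α₂ ≠ γ₁ + γ₂) :
    ∃ g : E.toAffine.FunctionField,
      HasValue β₁ g 1 ∧ HasValue β₂ g 1 ∧
      ((∃ α' γ' : E.toAffine.Point, HasDegree g 3 ∧
          HasDivisor g (pt α₁ + pt α₂ + pt α' - pt γ₁ - pt γ₂ - pt γ')) ∨
        (∃ γ' : E.toAffine.Point, ∃ γ ∈ ({γ₁, γ₂} : Set E.toAffine.Point), HasDegree g 2 ∧
          HasDivisor g (pt α₁ + pt α₂ - pt γ - pt γ')) ∨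
        (∃ α' : E.toAffine.Point, ∃ α ∈ ({α₁, α₂} : Set E.toAffine.Point), HasDegree g 2 ∧
          HasDivisor g (pt α + pt α' - pt γ₁ - pt γ₂))) := by
  obtain ⟨u, hu⟩ := exists_isPencil γ₁ γ₂
  obtain ⟨v, hv⟩ := exists_isPencil α₁ α₂
  have hαβ' := hαβ
  have hβγ' := hβγ
  simp only [Set.disjoint_insert_left, Set.disjoint_singleton_left, Set.mem_insert_iff,
    Set.mem_singleton_iff, not_or] at hαβ' hβγ'
  obtain ⟨⟨a₁b₁, a₁b₂⟩, a₂b₁, a₂b₂⟩ := hαβ'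
  obtain ⟨⟨b₁c₁, b₁c₂⟩, b₂c₁, b₂c₂⟩ := hβγ'
  obtain ⟨c₁, hc₁⟩ := hu.exists_hasValue b₁c₁ b₁c₂
  obtain ⟨c₂, hc₂⟩ := hu.exists_hasValue b₂c₁ b₂c₂
  obtain ⟨d₁, hd₁⟩ := hv.exists_hasValue (Ne.symm a₁b₁) (Ne.symm a₂b₁)
  obtain ⟨d₂, hd₂⟩ := hv.exists_hasValue (Ne.symm a₁b₂) (Ne.symm a₂b₂)
  have hc := sub_ne_zero.2 (hu.value_ne b₁c₁ b₁c₂ b₂c₁ b₂c₂ hβ sβγ hc₁ hc₂)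
  have hd := sub_ne_zero.2 (hv.value_ne (Ne.symm a₁b₁) (Ne.symm a₂b₁) (Ne.symm a₁b₂)
    (Ne.symm a₂b₂) hβ sαβ.symm hd₁ hd₂)
  -- The affine map t ↦ a t + (c₁ - a d₁) sends d₁, d₂ to c₁, c₂; its slope is nonzero since both
  -- pencils separate β₁ and β₂.
  set a := (c₁ - c₂) / (d₁ - d₂) with ha
  have hv' := hv.affine (div_ne_zero hc hd) (c₁ - a * d₁)
  obtain ⟨g, hg₁, hg₂, α', γ', hdisj, hg⟩ := exists_ratio_of_isPencil hαβ hβγ hαγ hβ sαγ hu hv'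
    (by
      convert hc₁.sub (((hasValue_algebraMap β₁ a).mul hd₁).add
        (hasValue_algebraMap β₁ (c₁ - a * d₁))) using 1
      ring)
    (by
      convert hc₂.sub (((hasValue_algebraMap β₂ a).mul hd₂).add
        (hasValue_algebraMap β₂ (c₁ - a * d₁))) using 1
      rw [ha]
      field_simp
      ring)
  exact ⟨g, hg₁, hg₂, .inl ⟨α', γ', ⟨_, hg, sum_toNat_eq_three hdisj⟩, hg⟩⟩
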